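/- **No-go result for the linear optics implementation of the phase gate.** *Setup.* Let $Q,P$ be the position and momentum operators on $L^2(\mathbb{R})$, so that $(e^{-isP}\psi)(x)=\psi(x-s)$, and for $\alpha>0$ let $(M_\alpha\psi)(x)=\alpha^{-1/2}\psi(x/\alpha)$. For $\kappa,\Delta>0$ put $\eta_\kappa(x)=\sqrt{\kappa}\,\pi^{-1/4}e^{-\kappa^2x^2/2}$ and $\Psi_\Delta(x)=\pi^{-1/4}\Delta^{-1/2}e^{-x^2/(2\Delta^2)}$. For $\varepsilon>0$ let $\Psi_\Delta^\varepsilon$ be the $L^2$-normalized restriction of $\Psi_\Delta$ to $[-\varepsilon,\varepsilon]$, and let $$\mathsf{GKP}^\varepsilon_{\kappa,\Delta}(x)=C_\kappa\sum_{z\in\mathbb{Z}}\eta_\kappa(z)\,\Psi^\varepsilon_\Delta(x-z),$$ with $C_\kappa>0$ chosen such that this is a unit vector. For an integer $d\ge 2$ and $\varepsilon\in(0,1/(2d)]$ the states $$\mathsf{GKP}^\varepsilon_{\kappa,\Delta}(j)_d=e^{-ij\sqrt{2\pi/d}\,P}M_{\sqrt{2\pi d}}\,\mathsf{GKP}^\varepsilon_{\kappa,\Delta},\qquad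 j\in\{0,\dots,d-1\},$$ are orthonormal. Their span is the truncated approximate GKP code $\mathcal{L}^\varepsilon_{\kappa,\Delta}[d]$, with isometric encoding map $\mathsf{Enc}:|j\rangle\mapsto\mathsf{GKP}^\varepsilon_{\kappa,\Delta}(j)_d$. The symmetrically squeezed code is $\mathcal{L}^\star_\kappa[d]:=\mathcal{L}^{1/(2d)}_{\kappa,\kappa/(2\pi d)}[d]$. For a code $\mathcal{L}=\mathsf{Enc}(\mathbb{C}^d)\subset\mathcal{H}$ with orthogonal projection $\pi_{\mathcal{L}}$, a unitary $U$ on $\mathbb{C}^d$ and a unitary $W$ on $\mathcal{H}$, let $\mathbf{U}=\mathsf{Enc}\,U\,\mathsf{Enc}^{-1}:\mathcal{L}\to\mathcal{L}$ and define the logical gate error by $$\mathsf{err}_{\mathcal{L}}(W,U)=\left\|(\mathcal{W}-\mathcal{U})\circ\Pi_{\mathcal{L}}\right\|_\diamond,\qquad \mathcal{W}(\rho)=W\rho W^\dagger,\quad \mathcal{U}(\rho)=\mathbf{U}\rho\mathbf{U}^\dagger,\quad \Pi_{\mathcal{L}}(\rho)=\pi_{\mathcal{L}}\rho\pi_{\mathcal{L}},$$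 where $\|\mathcal{E}\|_\diamond=\sup_{n\in\mathbb{N}}\sup_{\|A\|_1\le1}\|(\mathcal{E}\otimes\mathrm{id}_{\mathcal{B}(\mathbb{C}^n)})(A)\|_1$ is the diamond norm and $\|A\|_1=\mathrm{tr}\sqrt{A^\dagger A}$. *Theorem.* Let $d\ge 2$ be an integer and $c_d=d\bmod 2$. Let $\mathsf{P}|x\rangle=e^{i\pi x(x+c_d)/d}|x\rangle$ for $x\in\{0,\dots,d-1\}$ be the phase gate on $\mathbb{C}^d$, and let $W_{\mathsf{P}}=e^{i(Q^2+c_d\sqrt{2\pi/d}\,Q)/2}$ be its standard Gaussian implementation. 1. For all $\varepsilon\in(0,1/(2d)]$, all $\kappa\in(0,1/250)$ and all $\Delta>0$ with $2\pi d\Delta/\kappa\ge1$, $$\mathsf{err}_{\mathcal{L}^\varepsilon_{\kappa,\Delta}[d]}(W_{\mathsf{P}},\mathsf{P})\ \ge\ \tfrac1{25}-32\,(\Delta/\varepsilon)^2 .$$ 2. For all $\kappa\in(0,1/250)$, $$\mathsf{err}_{\mathcal{L}^\star_\kappa[d]}(W_{\mathsf{P}},\mathsf{P})\ \ge\ \tfrac{3}{100}.$$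 In particular, $\mathsf{err}_{\mathcal{L}^\star_\kappa[d]}(W_{\mathsf{P}},\mathsf{P})$ does not tend to $0$ as $\kappa\to0^+$. -/

import Mathlib

open MeasureTheory Filter Topology
open scoped ENNReal InnerProductSpace

/-! ### Trace norm and diamond norm -/

section Diamond

variable {X Y : Type*}
  [NormedAddCommGroup X] [InnerProductSpace ℂ X] [CompleteSpace X]
  [NormedAddCommGroup Y] [InnerProductSpace ℂ Y] [CompleteSpace Y]

/-- The trace norm `‖T‖₁ = tr √(T† T)` of a bounded operator on a Hilbert space, with values in
`[0, ∞]`.  The trace of the positive operator `|T| = √(T† T)` is the supremum of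
`∑ᵢ ⟨eᵢ, |T| eᵢ⟩` over all finite orthonormal families `e`; `T` is trace class iff this is finite. -/
noncomputable def traceNorm (T : X →L[ℂ] X) : ℝ≥0∞ :=
  ⨆ (m : ℕ) (e : Fin m → X) (_ : Orthonormal ℂ e),
    ∑ i, ENNReal.ofReal (RCLike.re ⟪e i, CFC.sqrt (star T * T) (e i)⟫_ℂ)

/-- The Hilbert space `X ⊗ ℂⁿ`, realized as the `n`-fold orthogonal direct sum of `X`
(`x ⊗ |j⟩` corresponds to `x` in the `j`-th summand). -/
abbrev TensorCn (X : Type*) (n : ℕ) : Type _ := PiLp 2 (fun _ : Fin n => X)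

/-- The map `x ↦ x ⊗ |j⟩` from `X` to `X ⊗ ℂⁿ`, i.e. the adjoint of the projection
`I ⊗ ⟨j|` to the `j`-th summand. -/
noncomputable def tensorKet (X : Type*) [NormedAddCommGroup X] [InnerProductSpace ℂ X]
    [CompleteSpace X] (n : ℕ) (j : Fin n) : X →L[ℂ] TensorCn X n :=
  ContinuousLinearMap.adjoint (PiLp.proj 2 (fun _ : Fin n => X) j)

/-- The map `𝓔 ⊗ id_{B(ℂⁿ)}`.  Writing `A = ∑ᵢⱼ Aᵢⱼ ⊗ |i⟩⟨j|` with blocks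
`Aᵢⱼ = (I ⊗ ⟨i|) A (I ⊗ |j⟩)`, it sends `A` to `∑ᵢⱼ 𝓔(Aᵢⱼ) ⊗ |i⟩⟨j|`. -/
noncomputable def tensorId (E : (X →L[ℂ] X) →ₗ[ℂ] (Y →L[ℂ] Y)) (n : ℕ)
    (A : TensorCn X n →L[ℂ] TensorCn X n) : TensorCn Y n →L[ℂ] TensorCn Y n :=
  ∑ i, ∑ j, tensorKet Y n i ∘L
    E (PiLp.proj 2 (fun _ : Fin n => X) i ∘L A ∘L tensorKet X n j) ∘L
      PiLp.proj 2 (fun _ : Fin n => Y) j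

/-- The diamond norm `‖𝓔‖_⋄ = supₙ ‖𝓔 ⊗ id_{B(ℂⁿ)}‖₁`, where the trace norm of a map of operators
is its operator norm with respect to the trace norms on the input and the output. -/
noncomputable def diamondNorm (E : (X →L[ℂ] X) →ₗ[ℂ] (Y →L[ℂ] Y)) : ℝ≥0∞ :=
  ⨆ (n : ℕ) (A : TensorCn X n →L[ℂ] TensorCn X n) (_ : traceNorm A ≤ 1),
    traceNorm (tensorId E n A)

/-- The completely positive map `ρ ↦ V ρ V†`. -/
noncomputable def conjMap (V : X →L[ℂ] Y) : (X →L[ℂ] X) →ₗ[ℂ] (Y →L[ℂ] Y) where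
  toFun ρ := V ∘L ρ ∘L ContinuousLinearMap.adjoint V
  map_add' ρ σ := by ext x; simp
  map_smul' c ρ := by ext x; simp

end Diamond

/-! ### Logical gate error -/

section GateError

variable {H : Type*} [NormedAddCommGroup H] [InnerProductSpace ℂ H] [CompleteSpace H] {d : ℕ}

/-- The code space `𝓛 = Enc(ℂᵈ)` of an isometric encoding map. -/
noncomputable abbrev codeSpace (Enc : EuclideanSpace ℂ (Fin d) →ₗᵢ[ℂ] H) : Submodule ℂ H :=
  LinearMap.range Enc.toLinearMap

/-- The decoding map `Dec = Enc⁻¹ : 𝓛 → ℂᵈ`. -/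
noncomputable def decoder (Enc : EuclideanSpace ℂ (Fin d) →ₗᵢ[ℂ] H) :
    codeSpace Enc ≃ₗᵢ[ℂ] EuclideanSpace ℂ (Fin d) :=
  Enc.equivRange.symm

/-- The logical unitary `𝐔 = Enc U Dec : 𝓛 → 𝓛`, regarded as a map `𝓛 → H`, of a unitary matrix
`U` on `ℂᵈ`. -/
noncomputable def logicalUnitary (Enc : EuclideanSpace ℂ (Fin d) →ₗᵢ[ℂ] H)
    (U : Matrix.unitaryGroup (Fin d) ℂ) : codeSpace Enc →L[ℂ] H :=
  Enc.toContinuousLinearMap ∘L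
    Matrix.toEuclideanCLM (n := Fin d) (𝕜 := ℂ) (U : Matrix (Fin d) (Fin d) ℂ) ∘L
      (decoder Enc : codeSpace Enc →L[ℂ] EuclideanSpace ℂ (Fin d))

/-- The logical gate error `err_𝓛(𝓦, U) = ‖(𝓦 - 𝓤) ∘ Π_𝓛‖_⋄` of a map `𝓦` on operators as an
implementation of the logical unitary `U`.  Here `Π_𝓛(ρ) = π_𝓛 ρ π_𝓛`, regarded as an operator on
`H` in the first term and as an operator on `𝓛` in the second one, and `𝓤(ρ) = 𝐔 ρ 𝐔†`. -/
noncomputable def logicalGateError (Enc : EuclideanSpace ℂ (Fin d) →ₗᵢ[ℂ] H)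
    (W : (H →L[ℂ] H) →ₗ[ℂ] (H →L[ℂ] H)) (U : Matrix.unitaryGroup (Fin d) ℂ) : ℝ≥0∞ :=
  diamondNorm
    (W ∘ₗ conjMap (codeSpace Enc).starProjection -
      conjMap (logicalUnitary Enc U) ∘ₗ conjMap (codeSpace Enc).orthogonalProjectionOnto)

end GateError

/-! ### Operators on `L²(ℝ)` -/

/-- The Hilbert space `L²(ℝ)` of complex-valued functions. -/
abbrev L2R : Type := Lp ℂ 2 (volume : Measure ℝ)

/-- The translation `e^{-isP}`, `(e^{-isP} ψ)(x) = ψ(x - s)`. -/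
noncomputable def translation (s : ℝ) : L2R →ₗᵢ[ℂ] L2R :=
  Lp.compMeasurePreservingₗᵢ ℂ (fun x : ℝ => x - s) (measurePreserving_sub_right volume s)

theorem eLpNorm_squeeze (α : ℝ) (hα : 0 < α) (f : L2R) :
    eLpNorm (fun x : ℝ => ((1 / √α : ℝ) : ℂ) * f (x / α)) 2 volume = eLpNorm f 2 volume := by
  have hmap : Measure.map (fun x : ℝ => x / α) volume = ENNReal.ofReal α • volume := by
    have := Real.map_volume_mul_right (a := α⁻¹) (inv_ne_zero hα.ne')
    simpa [div_eq_mul_inv, abs_of_pos hα] using this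
  have hmeas : Measurable (fun x : ℝ => x / α) := by fun_prop
  have h1 : eLpNorm (fun x : ℝ => f (x / α)) 2 volume
      = eLpNorm f 2 (ENNReal.ofReal α • volume) := by
    rw [← hmap, eLpNorm_map_measure _ hmeas.aemeasurable]
    · rfl
    · rw [hmap]
      exact (Lp.aestronglyMeasurable f).smul_measure _
  have h2 : (fun x : ℝ => ((1 / √α : ℝ) : ℂ) * f (x / α))
      = ((1 / √α : ℝ) : ℂ) • (fun x : ℝ => f (x / α)) := rfl
  rw [h2, eLpNorm_const_smul, h1, eLpNorm_smul_measure_of_ne_top (by simp)]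
  have hs : 0 < √α := Real.sqrt_pos.2 hα
  have h3 : ‖((1 / √α : ℝ) : ℂ)‖ₑ = ENNReal.ofReal (1 / √α) := by
    rw [← ofReal_norm, Complex.norm_real, Real.norm_of_nonneg (by positivity)]
  rw [h3, smul_eq_mul, ← mul_assoc, ENNReal.ofReal_rpow_of_pos hα,
    ← ENNReal.ofReal_mul (by positivity)]
  have h4 : 1 / √α * α ^ (1 / (2 : ℝ≥0∞)).toReal = 1 := by
    have : (1 / (2 : ℝ≥0∞)).toReal = 1 / 2 := by simp
    rw [this, ← Real.sqrt_eq_rpow]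
    field_simp
  rw [h4]
  simp

theorem memLp_squeeze (α : ℝ) (hα : 0 < α) (f : L2R) :
    MemLp (fun x : ℝ => ((1 / √α : ℝ) : ℂ) * f (x / α)) 2 volume := by
  refine ⟨?_, ?_⟩
  · have hq : Measure.QuasiMeasurePreserving (fun x : ℝ => x / α) volume volume := by
      refine ⟨by fun_prop, ?_⟩
      have := Real.map_volume_mul_right (a := α⁻¹) (inv_ne_zero hα.ne')
      simp only [div_eq_mul_inv]
      rw [this]
      exact Measure.smul_absolutelyContinuous
    exact ((Lp.aestronglyMeasurable f).comp_quasiMeasurePreserving hq).const_mul _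
  · rw [eLpNorm_squeeze α hα f]
    exact Lp.eLpNorm_lt_top f

theorem quasiMeasurePreserving_div (α : ℝ) (hα : 0 < α) :
    Measure.QuasiMeasurePreserving (fun x : ℝ => x / α) volume volume := by
  refine ⟨by fun_prop, ?_⟩
  have := Real.map_volume_mul_right (a := α⁻¹) (inv_ne_zero hα.ne')
  simp only [div_eq_mul_inv]
  rw [this]
  exact Measure.smul_absolutelyContinuous

/-- The squeezing operator `M_α = e^{-i (log α) (QP + PQ)/2}`, `(M_α ψ)(x) = α^{-1/2} ψ(x/α)`. -/
noncomputable def squeezing (α : ℝ) (hα : 0 < α) : L2R →ₗᵢ[ℂ] L2R where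
  toFun f := (memLp_squeeze α hα f).toLp _
  map_add' f g := by
    rw [← MemLp.toLp_add, MemLp.toLp_eq_toLp_iff]
    filter_upwards [(quasiMeasurePreserving_div α hα).ae (Lp.coeFn_add f g)] with x hx
    simp only [Pi.add_apply, hx, mul_add]
  map_smul' c f := by
    simp only [RingHom.id_apply]
    rw [← MemLp.toLp_const_smul, MemLp.toLp_eq_toLp_iff]
    filter_upwards [(quasiMeasurePreserving_div α hα).ae (Lp.coeFn_smul c f)] with x hx
    simp [hx]
    ring
  norm_map' f := by
    simp only [LinearMap.coe_mk, AddHom.coe_mk]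
    rw [Lp.norm_toLp, eLpNorm_squeeze α hα f, Lp.norm_def]

theorem memLp_phase (θ : ℝ → ℝ) (hθ : Continuous θ) (f : L2R) :
    MemLp (fun x : ℝ => Complex.exp (Complex.I * θ x) * f x) 2 volume := by
  refine (Lp.memLp f).of_le (.mul (by fun_prop) (Lp.aestronglyMeasurable f)) ?_
  filter_upwards with x
  rw [norm_mul, mul_comm Complex.I, Complex.norm_exp_ofReal_mul_I, one_mul]

/-- The unitary `e^{iθ(Q)}` for a continuous real function `θ` of the position operator `Q`, i.e.
the multiplication operator `(e^{iθ(Q)} ψ)(x) = e^{iθ(x)} ψ(x)`. -/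
noncomputable def phaseUnitary (θ : ℝ → ℝ) (hθ : Continuous θ) : L2R ≃ₗᵢ[ℂ] L2R where
  toFun f := (memLp_phase θ hθ f).toLp _
  invFun f := (memLp_phase (fun x => -θ x) hθ.neg f).toLp _
  map_add' f g := by
    rw [← MemLp.toLp_add, MemLp.toLp_eq_toLp_iff]
    filter_upwards [Lp.coeFn_add f g] with x hx
    simp only [Pi.add_apply, hx, mul_add]
  map_smul' c f := by
    simp only [RingHom.id_apply]
    rw [← MemLp.toLp_const_smul, MemLp.toLp_eq_toLp_iff]
    filter_upwards [Lp.coeFn_smul c f] with x hx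
    simp [hx]
    ring
  left_inv f := by
    simp only
    conv_rhs => rw [← Lp.toLp_coeFn f (Lp.memLp f)]
    rw [MemLp.toLp_eq_toLp_iff]
    filter_upwards [(memLp_phase θ hθ f).coeFn_toLp] with x hx
    rw [hx, ← mul_assoc, ← Complex.exp_add]
    simp
  right_inv f := by
    simp only
    conv_rhs => rw [← Lp.toLp_coeFn f (Lp.memLp f)]
    rw [MemLp.toLp_eq_toLp_iff]
    filter_upwards [(memLp_phase (fun x => -θ x) hθ.neg f).coeFn_toLp] with x hx
    rw [hx, ← mul_assoc, ← Complex.exp_add]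
    simp
  norm_map' f := by
    simp only [LinearEquiv.coe_mk, LinearMap.coe_mk, AddHom.coe_mk]
    rw [Lp.norm_toLp, Lp.norm_def]
    congr 1
    refine eLpNorm_congr_norm_ae ?_
    filter_upwards with x
    rw [norm_mul, mul_comm Complex.I, Complex.norm_exp_ofReal_mul_I, one_mul]

/-! ### Truncated approximate GKP codes -/

/-- The envelope `η_κ(x) = √κ π^{-1/4} e^{-κ² x² / 2}`. -/
noncomputable def gkpEnvelope (κ x : ℝ) : ℝ :=
  √κ / Real.pi ^ (1 / 4 : ℝ) * Real.exp (-κ ^ 2 * x ^ 2 / 2)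

/-- The Gaussian peak `Ψ_Δ(x) = π^{-1/4} Δ^{-1/2} e^{-x² / (2 Δ²)}`. -/
noncomputable def gkpPeak (Δ x : ℝ) : ℝ :=
  1 / (Real.pi ^ (1 / 4 : ℝ) * √Δ) * Real.exp (-x ^ 2 / (2 * Δ ^ 2))

theorem continuous_gkpPeak (Δ : ℝ) : Continuous (gkpPeak Δ) := by
  unfold gkpPeak
  fun_prop

theorem memLp_cutPeak (Δ ε : ℝ) :
    MemLp ((Set.Icc (-ε) ε).indicator (fun x : ℝ => (gkpPeak Δ x : ℂ))) 2 volume := by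
  rw [memLp_indicator_iff_restrict measurableSet_Icc]
  have hc : Continuous (fun x : ℝ => (gkpPeak Δ x : ℂ)) :=
    Complex.continuous_ofReal.comp (continuous_gkpPeak Δ)
  obtain ⟨C, hC⟩ := isCompact_Icc.exists_bound_of_continuousOn (s := Set.Icc (-ε) ε) hc.continuousOn
  refine MemLp.of_bound hc.aestronglyMeasurable C ?_
  filter_upwards [ae_restrict_mem measurableSet_Icc] with x hx using hC x hx

/-- The restriction `Π_{[-ε, ε]} Ψ_Δ` of the Gaussian peak to `[-ε, ε]`. -/
noncomputable def cutPeak (Δ ε : ℝ) : L2R := (memLp_cutPeak Δ ε).toLp _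

/-- The normalization `v / ‖v‖` of a vector. -/
noncomputable def normalized (v : L2R) : L2R := ((‖v‖⁻¹ : ℝ) : ℂ) • v

/-- The truncated Gaussian `χ_Δ^ε(z)` centered at `z`: the translate by `z` of
`Ψ_Δ^ε = Π_{[-ε, ε]} Ψ_Δ / ‖Π_{[-ε, ε]} Ψ_Δ‖`. -/
noncomputable def truncPeak (Δ ε z : ℝ) : L2R := translation z (normalized (cutPeak Δ ε))

/-- The `ε`-truncated approximate GKP state `C_κ ∑_{z ∈ ℤ} η_κ(z) χ_Δ^ε(z)`, with `C_κ > 0` the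
normalization constant. -/
noncomputable def gkpState (κ Δ ε : ℝ) : L2R :=
  normalized (∑' z : ℤ, ((gkpEnvelope κ z : ℝ) : ℂ) • truncPeak Δ ε z)

/-- The code state `e^{-ij√(2π/d)P} M_{√(2πd)} GKP_{κ,Δ}^ε`, for `j ∈ {0, …, d-1}`. -/
noncomputable def gkpCodeState (d : ℕ) (hd : 0 < d) (κ Δ ε : ℝ) (j : Fin d) : L2R :=
  translation (j * √(2 * Real.pi / d))
    (squeezing (√(2 * Real.pi * d)) (by positivity) (gkpState κ Δ ε))

theorem ae_zero_translation {f : L2R} {a b : ℝ} (s : ℝ)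
    (hf : ∀ᵐ x : ℝ, x ∉ Set.Icc a b → f x = 0) :
    ∀ᵐ x : ℝ, x ∉ Set.Icc (a + s) (b + s) → translation s f x = 0 := by
  have hmp := measurePreserving_sub_right (volume : Measure ℝ) s
  filter_upwards [Lp.coeFn_compMeasurePreserving f hmp, hmp.quasiMeasurePreserving.ae hf]
    with x h1 h2 hx
  have h3 : translation s f x = f (x - s) := h1
  rw [h3]
  refine h2 fun h => hx ⟨?_, ?_⟩ <;> linarith [h.1, h.2]

theorem ae_zero_squeezing {f : L2R} {a b : ℝ} (α : ℝ) (hα : 0 < α)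
    (hf : ∀ᵐ x : ℝ, x ∉ Set.Icc a b → f x = 0) :
    ∀ᵐ x : ℝ, x ∉ Set.Icc (α * a) (α * b) → squeezing α hα f x = 0 := by
  filter_upwards [(memLp_squeeze α hα f).coeFn_toLp, (quasiMeasurePreserving_div α hα).ae hf]
    with x h1 h2 hx
  have h3 : squeezing α hα f x = ((1 / √α : ℝ) : ℂ) * f (x / α) := h1
  rw [h3, h2, mul_zero]
  intro h
  refine hx ⟨?_, ?_⟩
  · have := (le_div_iff₀ hα).1 h.1
    linarith
  · have := (div_le_iff₀ hα).1 h.2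
    linarith

theorem ae_zero_truncPeak (Δ ε z : ℝ) :
    ∀ᵐ x : ℝ, x ∉ Set.Icc (-ε + z) (ε + z) → truncPeak Δ ε z x = 0 := by
  refine ae_zero_translation z ?_
  filter_upwards [Lp.coeFn_smul ((‖cutPeak Δ ε‖⁻¹ : ℝ) : ℂ) (cutPeak Δ ε),
    (memLp_cutPeak Δ ε).coeFn_toLp] with x h1 h2 hx
  have h3 : normalized (cutPeak Δ ε) x = ((‖cutPeak Δ ε‖⁻¹ : ℝ) : ℂ) • cutPeak Δ ε x := h1
  have h4 : cutPeak Δ ε x = 0 := by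
    have : cutPeak Δ ε x = (Set.Icc (-ε) ε).indicator (fun x : ℝ => (gkpPeak Δ x : ℂ)) x := h2
    rw [this, Set.indicator_of_notMem hx]
  rw [h3, h4, smul_zero]

theorem inner_eq_zero_of_ae_zero {f g : L2R} {a b a' b' : ℝ}
    (hf : ∀ᵐ x : ℝ, x ∉ Set.Icc a b → f x = 0) (hg : ∀ᵐ x : ℝ, x ∉ Set.Icc a' b' → g x = 0)
    (h : b ≤ a' ∨ b' ≤ a) : ⟪f, g⟫_ℂ = 0 := by
  rw [L2.inner_def]
  refine integral_eq_zero_of_ae ?_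
  have hne : ∀ c : ℝ, ∀ᵐ x : ℝ, x ≠ c := fun c => by
    simp [ae_iff]
  filter_upwards [hf, hg, hne b, hne a] with x h1 h2 h3 h4
  by_cases hx : x ∈ Set.Icc a b
  · rw [h2, inner_zero_right]
    · rfl
    · rintro ⟨h5, h6⟩
      rcases h with h | h
      · exact h3 (le_antisymm hx.2 (h.trans h5))
      · exact h4 (le_antisymm (h6.trans h) hx.1)
  · rw [h1 hx, inner_zero_left]
    rfl

theorem cutPeak_ne_zero {Δ ε : ℝ} (hΔ : 0 < Δ) (hε : 0 < ε) : cutPeak Δ ε ≠ 0 := by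
  intro h
  have h1 : (Set.Icc (-ε) ε).indicator (fun x : ℝ => (gkpPeak Δ x : ℂ)) =ᵐ[volume] 0 := by
    refine (memLp_cutPeak Δ ε).coeFn_toLp.symm.trans ?_
    have : ((memLp_cutPeak Δ ε).toLp _ : L2R) = 0 := h
    rw [this]
    exact Lp.coeFn_zero ℂ 2 volume
  have h2 : (volume : Measure ℝ) (Set.Icc (-ε) ε) = 0 := by
    refine measure_mono_null (fun x hx => ?_) (ae_iff.1 h1)
    have : 0 < gkpPeak Δ x := by
      unfold gkpPeak
      have := Real.pi_pos
      have := Real.sqrt_pos.2 hΔ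
      positivity
    rw [Set.mem_ofPred_eq, Set.indicator_of_mem hx]
    simpa using this.ne'
  rw [Real.volume_Icc, ENNReal.ofReal_eq_zero] at h2
  linarith

theorem norm_normalized {v : L2R} (hv : v ≠ 0) : ‖normalized v‖ = 1 := by
  unfold normalized
  rw [norm_smul, Complex.norm_real, norm_inv, norm_norm, inv_mul_cancel₀ (norm_ne_zero_iff.2 hv)]

theorem norm_truncPeak {Δ ε : ℝ} (hΔ : 0 < Δ) (hε : 0 < ε) (z : ℝ) :
    ‖truncPeak Δ ε z‖ = 1 := by
  unfold truncPeak
  rw [LinearIsometry.norm_map, norm_normalized (cutPeak_ne_zero hΔ hε)]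

theorem summable_gkpEnvelope {κ : ℝ} (hκ : 0 < κ) : Summable fun z : ℤ => gkpEnvelope κ z := by
  have hπ := Real.pi_pos
  have h := summable_pow_mul_jacobiTheta₂_term_bound 0 (T := κ ^ 2 / (2 * Real.pi))
    (by positivity) 0
  refine Summable.mul_left _ (h.congr fun z => ?_)
  simp only [pow_zero, one_mul]
  congr 1
  field_simp
  ring

theorem summable_gkp {κ Δ ε : ℝ} (hκ : 0 < κ) (hΔ : 0 < Δ) (hε : 0 < ε) :
    Summable fun z : ℤ => ((gkpEnvelope κ z : ℝ) : ℂ) • truncPeak Δ ε z := by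
  refine Summable.of_norm ((summable_gkpEnvelope hκ).congr fun z => ?_)
  have : 0 ≤ gkpEnvelope κ z := by unfold gkpEnvelope; positivity
  rw [norm_smul, norm_truncPeak hΔ hε, mul_one, Complex.norm_real, Real.norm_of_nonneg this]

theorem inner_tsum_right {ι : Type*} {f : ι → L2R} (hf : Summable f) (v : L2R) :
    ⟪v, ∑' i, f i⟫_ℂ = ∑' i, ⟪v, f i⟫_ℂ :=
  (innerSL ℂ v).map_tsum hf

theorem inner_tsum_left_eq_zero {ι : Type*} {f : ι → L2R} (hf : Summable f) (v : L2R)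
    (h : ∀ i, ⟪f i, v⟫_ℂ = 0) : ⟪∑' i, f i, v⟫_ℂ = 0 := by
  rw [← inner_conj_symm, inner_tsum_right hf]
  simp [fun i => (inner_eq_zero_symm (𝕜 := ℂ)).1 (h i)]

theorem gkpSum_ne_zero {κ Δ ε : ℝ} (hκ : 0 < κ) (hΔ : 0 < Δ) (hε : 0 < ε) (hε2 : ε ≤ 1 / 2) :
    (∑' z : ℤ, ((gkpEnvelope κ z : ℝ) : ℂ) • truncPeak Δ ε z) ≠ 0 := by
  intro h
  have h1 : ⟪truncPeak Δ ε (0 : ℤ),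
      ∑' z : ℤ, ((gkpEnvelope κ z : ℝ) : ℂ) • truncPeak Δ ε z⟫_ℂ = (gkpEnvelope κ (0 : ℤ) : ℂ) := by
    rw [inner_tsum_right (summable_gkp hκ hΔ hε), tsum_eq_single 0]
    · rw [inner_smul_right, inner_self_eq_norm_sq_to_K, norm_truncPeak hΔ hε]
      simp
    · intro z hz
      rw [inner_smul_right, inner_eq_zero_of_ae_zero (ae_zero_truncPeak Δ ε _)
        (ae_zero_truncPeak Δ ε _), mul_zero]
      rcases lt_or_gt_of_ne hz with h | h
      · right
        have : (z : ℝ) ≤ -1 := by exact_mod_cast Int.le_sub_one_of_lt h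
        push_cast
        linarith
      · left
        have : (1 : ℝ) ≤ z := by exact_mod_cast h
        push_cast
        linarith
  rw [h, inner_zero_right] at h1
  have h2 : 0 < gkpEnvelope κ (0 : ℤ) := by
    unfold gkpEnvelope
    have := Real.pi_pos
    have := Real.sqrt_pos.2 hκ
    positivity
  exact h2.ne' (by exact_mod_cast h1.symm)

theorem orthonormal_gkpCodeState (d : ℕ) (hd : 0 < d) {κ Δ ε : ℝ} (hκ : 0 < κ) (hΔ : 0 < Δ)
    (hε : 0 < ε) (hεd : ε ≤ 1 / (2 * d)) : Orthonormal ℂ (gkpCodeState d hd κ Δ ε) := by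
  have hd1 : (1 : ℝ) ≤ d := by exact_mod_cast hd
  have hd0 : (0 : ℝ) < d := by linarith
  have hπ := Real.pi_pos
  have hε2 : ε ≤ 1 / 2 := by
    refine hεd.trans ?_
    gcongr
    linarith
  constructor
  · intro j
    unfold gkpCodeState gkpState
    rw [LinearIsometry.norm_map, LinearIsometry.norm_map,
      norm_normalized (gkpSum_ne_zero hκ hΔ hε hε2)]
  · intro j k hjk
    set α : ℝ := √(2 * Real.pi * d) with hα
    have hα0 : 0 < α := by positivity
    have hs : √(2 * Real.pi / d) = α / d := by
      rw [hα, eq_div_iff hd0.ne']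
      nth_rewrite 2 [← Real.sqrt_sq hd0.le]
      rw [← Real.sqrt_mul (by positivity)]
      congr 1
      field_simp
    have hsum := summable_gkp hκ hΔ hε
    have key : ∀ j : Fin d, gkpCodeState d hd κ Δ ε j =
        ((‖∑' z : ℤ, ((gkpEnvelope κ z : ℝ) : ℂ) • truncPeak Δ ε z‖⁻¹ : ℝ) : ℂ) •
          ∑' z : ℤ, ((gkpEnvelope κ z : ℝ) : ℂ) •
            translation (j * √(2 * Real.pi / d)) (squeezing α hα0 (truncPeak Δ ε z)) := by
      intro j
      unfold gkpCodeState gkpState normalized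
      rw [LinearIsometry.map_smul, LinearIsometry.map_smul]
      congr 1
      have := ((translation (j * √(2 * Real.pi / d))).toContinuousLinearMap ∘L
        (squeezing α hα0).toContinuousLinearMap).map_tsum hsum
      simp only [map_smul] at this
      exact this
    have hsum' : ∀ j : Fin d, Summable fun z : ℤ => ((gkpEnvelope κ z : ℝ) : ℂ) •
        translation (j * √(2 * Real.pi / d)) (squeezing α hα0 (truncPeak Δ ε z)) := by
      intro j
      have := ((translation (j * √(2 * Real.pi / d))).toContinuousLinearMap ∘L
        (squeezing α hα0).toContinuousLinearMap).summable hsum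
      simp only [map_smul] at this
      exact this
    rw [key j, key k, inner_smul_left, inner_smul_right, inner_tsum_left_eq_zero (hsum' j),
      mul_zero, mul_zero]
    intro z
    rw [inner_tsum_right (hsum' k)]
    refine (tsum_congr fun w => ?_).trans tsum_zero
    rw [inner_smul_left, inner_smul_right, inner_eq_zero_of_ae_zero
      (ae_zero_translation _ (ae_zero_squeezing α hα0 (ae_zero_truncPeak Δ ε z)))
      (ae_zero_translation _ (ae_zero_squeezing α hα0 (ae_zero_truncPeak Δ ε w))),
      mul_zero, mul_zero]
    rw [hs]
    have hn : (z * d + j : ℤ) ≠ w * d + k := by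
      intro h
      have h1 : ((z * d + j : ℤ) % d) = (w * d + k : ℤ) % d := by rw [h]
      rw [Int.mul_add_emod_self_right, Int.mul_add_emod_self_right,
        Int.emod_eq_of_lt (by positivity) (by exact_mod_cast j.2),
        Int.emod_eq_of_lt (by positivity) (by exact_mod_cast k.2)] at h1
      exact hjk (Fin.ext (by exact_mod_cast h1))
    have hεα : α * ε * 2 ≤ α / d := by
      have : α * ε ≤ α * (1 / (2 * d)) := by gcongr
      calc α * ε * 2 ≤ α * (1 / (2 * d)) * 2 := by linarith
        _ = α / d := by field_simp
    have aux : ∀ (a b : ℤ) (p q : Fin d), (a * d + p : ℤ) < b * d + q →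
        α * (ε + a) + p * (α / d) ≤ α * (-ε + b) + q * (α / d) := by
      intro a b p q h
      have h1 : (a * d + p : ℝ) + 1 ≤ b * d + q := by exact_mod_cast h
      have h2 : (α / d) * ((a * d + p : ℝ) + 1) ≤ (α / d) * (b * d + q) := by gcongr
      have h3 : ∀ c : ℝ, (α / d) * (c * d) = α * c := fun c => by field_simp
      have h4 := h3 a
      have h5 := h3 b
      nlinarith
    rcases lt_or_gt_of_ne hn with h | h
    · exact Or.inl (aux z w j k h)
    · exact Or.inr (aux w z k j h)

/-- The encoding map `|j⟩ ↦ e^{-ij√(2π/d)P} M_{√(2πd)} GKP_{κ,Δ}^ε` of the truncated approximate GKP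
code with parameters `κ`, `Δ`, `ε`, extended linearly to `ℂᵈ`. -/
noncomputable def gkpEncoder (d : ℕ) (hd : 0 < d) (κ Δ ε : ℝ) (hκ : 0 < κ) (hΔ : 0 < Δ)
    (hε : 0 < ε) (hεd : ε ≤ 1 / (2 * d)) : EuclideanSpace ℂ (Fin d) →ₗᵢ[ℂ] L2R :=
  ((EuclideanSpace.basisFun (Fin d) ℂ).toBasis.constr ℂ
    (gkpCodeState d hd κ Δ ε)).isometryOfOrthonormal
      (v := (EuclideanSpace.basisFun (Fin d) ℂ).toBasis)
      (by simp)
      (by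
        have : (⇑((EuclideanSpace.basisFun (Fin d) ℂ).toBasis.constr ℂ
            (gkpCodeState d hd κ Δ ε)) ∘ (EuclideanSpace.basisFun (Fin d) ℂ).toBasis)
            = gkpCodeState d hd κ Δ ε := by
          funext j
          simp only [Function.comp_apply, Module.Basis.constr_basis]
        rw [this]
        exact orthonormal_gkpCodeState d hd hκ hΔ hε hεd)

/-- The encoding map of the symmetrically squeezed approximate GKP code with the optimal truncation
parameter: `Δ = κ / (2πd)` and `ε = 1 / (2d)`. -/
noncomputable def symGkpEncoder (d : ℕ) (hd : 0 < d) (κ : ℝ) (hκ : 0 < κ) :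
    EuclideanSpace ℂ (Fin d) →ₗᵢ[ℂ] L2R :=
  gkpEncoder d hd κ (κ / (2 * Real.pi * d)) (1 / (2 * d)) hκ
    (by have := Real.pi_pos; positivity) (by positivity) le_rfl

/-! ### The phase gate and its standard Gaussian implementation -/

/-- `c_d = d mod 2`. -/
noncomputable def parityConst (d : ℕ) : ℝ := ((d % 2 : ℕ) : ℝ)

/-- The logical phase gate `P |x⟩ = e^{iπ x (x + c_d) / d} |x⟩`, for `x ∈ {0, …, d-1}`. -/
noncomputable def phaseGate (d : ℕ) : Matrix.unitaryGroup (Fin d) ℂ :=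
  ⟨Matrix.diagonal fun x : Fin d =>
      Complex.exp (((Real.pi * x * (x + parityConst d) / d : ℝ) : ℂ) * Complex.I), by
    rw [Matrix.mem_unitaryGroup_iff, Matrix.star_eq_conjTranspose, Matrix.diagonal_conjTranspose,
      Matrix.diagonal_mul_diagonal, ← Matrix.diagonal_one]
    congr 1
    funext x
    rw [Pi.star_apply, Complex.star_def, Complex.mul_conj, Complex.normSq_eq_norm_sq,
      Complex.norm_exp_ofReal_mul_I]
    simp⟩

/-- The Gaussian unitary `e^{i (Q² + c_d √(2π/d) Q) / 2}`. -/
noncomputable def phaseImplementation (d : ℕ) : L2R ≃ₗᵢ[ℂ] L2R :=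
  phaseUnitary (fun x => (x ^ 2 + parityConst d * √(2 * Real.pi / d) * x) / 2) (by fun_prop)

/-- The channel `ρ ↦ W ρ W†` of the unitary `W = e^{i (Q² + c_d √(2π/d) Q) / 2}`. -/
noncomputable def phaseChannel (d : ℕ) : (L2R →L[ℂ] L2R) →ₗ[ℂ] (L2R →L[ℂ] L2R) :=
  conjMap (phaseImplementation d : L2R →L[ℂ] L2R)

/-! ### Lower bounds on the diamond norm from pure inputs -/

section Diamond

variable {X Y : Type*}
  [NormedAddCommGroup X] [InnerProductSpace ℂ X] [CompleteSpace X]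
  [NormedAddCommGroup Y] [InnerProductSpace ℂ Y] [CompleteSpace Y]

/-! A single input state already witnesses the error. The phase gate fixes `|0⟩`, so a perfect
implementation would map the code state `g` of `|0⟩` to itself up to a phase. Feeding `|g⟩⟨g|` into
the difference of channels, without any ancilla, bounds the error below by `1 - |⟨g, W g⟩|²`
(`one_sub_sq_overlap_le_logicalGateError`). It remains to keep the overlap `|⟨g, W g⟩|` away from 1.

Undoing the squeezing turns `W` into multiplication by `exp(iφ)` with `φ(y) = π(d y² + c_d y)`. Near
the peak at the integer `z`, write `y = x + z`. Then `φ(x + z) = φ(x) + 2πd x z + π(d z² + c_d z)`,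
and the last term is a multiple of `2π` (`even_mul_mul_add_parity`). The quadratic phase therefore
acts correctly at the integers, but at an offset `x` from them it leaves the factor `exp(2πi d x
z)`.

Since distinct peaks do not overlap, the overlap is the average over `x`, with the density of one
truncated peak, of `exp(iφ(x))` times the characteristic function at `θ = 2πd x` of the discrete
Gaussian with weights proportional to `η_κ(z)²`. Poisson summation bounds that function by
`exp(-θ²/(4κ²)) + 1/100` for `|θ| ≤ π` (`norm_tsum_gaussian_mul_exp_le`). Because `κ ≤ 2πdΔ`, the
exponential is at most `exp(-x²/(4Δ²))`, whose mean against the Gaussian density of width `Δ` is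
`√(4/5) < 9/10`. Envelope and peak widths are thus tied so that shrinking `κ` brings no improvement.
With the truncation losses the overlap is at most `93/100` (`norm_inner_phaseUnitary_gkpState_le`).
-/

theorem adjoint_tensorKet (n : ℕ) (j : Fin n) :
    ContinuousLinearMap.adjoint (tensorKet X n j) = PiLp.proj 2 (fun _ : Fin n => X) j :=
  ContinuousLinearMap.adjoint_adjoint _

theorem tensorKet_apply_self (n : ℕ) (j : Fin n) (x : X) : tensorKet X n j x j = x := by
  classical
  refine ext_inner_left ℂ fun v => ?_
  have h : ⟪PiLp.single 2 j v, tensorKet X n j x⟫_ℂ = ⟪v, x⟫_ℂ := by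
    rw [tensorKet, ContinuousLinearMap.adjoint_inner_right]
    simp
  rw [← h, PiLp.inner_apply, Finset.sum_eq_single j]
  · simp
  · intro i _ hi
    simp [hi]
  · simp

theorem inner_tensorKet (n : ℕ) (j : Fin n) (x y : X) :
    ⟪tensorKet X n j x, tensorKet X n j y⟫_ℂ = ⟪x, y⟫_ℂ := by
  rw [← ContinuousLinearMap.adjoint_inner_right, adjoint_tensorKet]
  change ⟪x, tensorKet X n j y j⟫_ℂ = _
  rw [tensorKet_apply_self]

theorem norm_tensorKet (n : ℕ) (j : Fin n) (x : X) : ‖tensorKet X n j x‖ = ‖x‖ := by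
  rw [@norm_eq_sqrt_re_inner ℂ, @norm_eq_sqrt_re_inner ℂ _ _ _ _ x, inner_tensorKet]

open InnerProductSpace in
theorem conjMap_rankOne (V : X →L[ℂ] Y) (x y : X) :
    conjMap V (rankOne ℂ x y) = rankOne ℂ (V x) (V y) := by
  ext z
  simp [conjMap, ContinuousLinearMap.adjoint_inner_right]

-- A one-dimensional ancilla (`n = 1`) suffices for the lower bound, and there the ancilla extension
-- is just `E` conjugated by the isometry `X ≅ X ⊗ ℂ¹`.
open InnerProductSpace in
theorem tensorId_one_rankOne (E : (X →L[ℂ] X) →ₗ[ℂ] (Y →L[ℂ] Y)) (x y : X) :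
    tensorId E 1 (rankOne ℂ (tensorKet X 1 0 x) (tensorKet X 1 0 y)) =
      conjMap (tensorKet Y 1 0) (E (rankOne ℂ x y)) := by
  have h : PiLp.proj 2 (fun _ : Fin 1 => X) 0 ∘L
      rankOne ℂ (tensorKet X 1 0 x) (tensorKet X 1 0 y) ∘L tensorKet X 1 0 = rankOne ℂ x y := by
    ext z
    simp [inner_tensorKet, tensorKet_apply_self]
  simp only [tensorId, Fin.sum_univ_one, Fin.isValue]
  rw [h]
  simp [conjMap, adjoint_tensorKet]

open InnerProductSpace in
theorem traceNorm_rankOne_self_le {x : X} (hx : ‖x‖ = 1) : traceNorm (rankOne ℂ x x) ≤ 1 := by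
  have h0 : CFC.sqrt (star (rankOne ℂ x x) * rankOne ℂ x x) = rankOne ℂ x x :=
    CFC.abs_of_nonneg _
      ((ContinuousLinearMap.nonneg_iff_isPositive _).2 (isPositive_rankOne_self x))
  refine iSup_le fun m => iSup_le fun e => iSup_le fun he => ?_
  rw [h0, ← ENNReal.ofReal_sum_of_nonneg]
  · rw [ENNReal.ofReal_le_one]
    -- The projection is its own absolute value, so its partial traces are sums of squared
    -- coefficients of `x`, controlled by Bessel's inequality.
    have h1 := he.sum_inner_products_le x (s := Finset.univ)
    rw [hx, one_pow] at h1
    refine le_trans (le_of_eq (Finset.sum_congr rfl fun i _ => ?_)) h1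
    rw [rankOne_apply, inner_smul_right, inner_mul_symm_re_eq_norm, norm_mul, norm_inner_symm, sq]
  · intro i _
    rw [rankOne_apply, inner_smul_right, inner_mul_symm_re_eq_norm]
    positivity

/-- `|T| + T` is twice the positive part of `T`, hence positive. So `-⟨e, T e⟩ ≤ ⟨e, |T| e⟩`, and
the right side is a one-vector partial trace of `|T|`. -/
theorem ofReal_neg_inner_le_traceNorm {T : X →L[ℂ] X} (hT : IsSelfAdjoint T) {e : X}
    (he : ‖e‖ = 1) : ENNReal.ofReal (-RCLike.re ⟪e, T e⟫_ℂ) ≤ traceNorm T := by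
  have h1 : 0 ≤ CFC.abs T + T := by
    rw [CFC.abs_add_self T hT]
    exact nsmul_nonneg (CFC.posPart_nonneg T) 2
  have h2 := ((ContinuousLinearMap.nonneg_iff_isPositive _).1 h1).re_inner_nonneg_right e
  rw [add_apply, inner_add_right, map_add] at h2
  have h3 : Orthonormal ℂ (fun _ : Fin 1 => e) := ⟨fun _ => he, fun i j hij =>
    absurd (Subsingleton.elim i j) hij⟩
  refine le_trans ?_ (le_iSup_of_le 1 (le_iSup_of_le _ (le_iSup_of_le h3 le_rfl)))
  rw [Fin.sum_univ_one]
  refine ENNReal.ofReal_le_ofReal ?_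
  change _ ≤ RCLike.re ⟪e, CFC.abs T e⟫_ℂ
  linarith

end Diamond

/-! ### From the gate error to an overlap of states -/

section GateError

variable {H : Type*} [NormedAddCommGroup H] [InnerProductSpace ℂ H] [CompleteSpace H] {d : ℕ}

omit [CompleteSpace H] in
theorem logicalUnitary_apply (Enc : EuclideanSpace ℂ (Fin d) →ₗᵢ[ℂ] H)
    (U : Matrix.unitaryGroup (Fin d) ℂ) (v : EuclideanSpace ℂ (Fin d)) :
    logicalUnitary Enc U ((codeSpace Enc).orthogonalProjectionOnto (Enc v)) =
      Enc (Matrix.toEuclideanCLM (n := Fin d) (𝕜 := ℂ) (U : Matrix (Fin d) (Fin d) ℂ) v) := by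
  have h1 : (codeSpace Enc).orthogonalProjectionOnto (Enc v) = Enc.equivRange v :=
    Submodule.orthogonalProjectionOnto_mem_subspace_eq_self (Enc.equivRange v)
  rw [h1]
  simp [logicalUnitary, decoder]

/-- The pure-state lower bound on the logical gate error of a unitary implementation. -/
theorem one_sub_sq_overlap_le_logicalGateError (Enc : EuclideanSpace ℂ (Fin d) →ₗᵢ[ℂ] H)
    (W : H →L[ℂ] H) (U : Matrix.unitaryGroup (Fin d) ℂ) {v w : EuclideanSpace ℂ (Fin d)}
    (hv : ‖v‖ = 1) (hw : ‖w‖ = 1)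
    (h : Matrix.toEuclideanCLM (n := Fin d) (𝕜 := ℂ) (U : Matrix (Fin d) (Fin d) ℂ) v = w) :
    ENNReal.ofReal (1 - ‖⟪Enc w, W (Enc v)⟫_ℂ‖ ^ 2) ≤ logicalGateError Enc (conjMap W) U := by
  set a := tensorKet H 1 0 (W (Enc v)) with ha
  set b := tensorKet H 1 0 (Enc w) with hb
  have hb1 : ‖b‖ = 1 := by rw [hb, norm_tensorKet, Enc.norm_map, hw]
  -- Difference of the actual and the ideal output; testing it on the ideal output `b` gives `⟨b, T
  -- b⟩ = |⟨b, a⟩|² - 1`.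
  set T : TensorCn H 1 →L[ℂ] TensorCn H 1 :=
    InnerProductSpace.rankOne ℂ a a - InnerProductSpace.rankOne ℂ b b with hT
  have hsa : IsSelfAdjoint T := by
    rw [ContinuousLinearMap.isSelfAdjoint_iff']
    simp [hT]
  have h1 := ofReal_neg_inner_le_traceNorm hsa hb1
  have h2 : -RCLike.re ⟪b, T b⟫_ℂ = 1 - ‖⟪Enc w, W (Enc v)⟫_ℂ‖ ^ 2 := by
    rw [hT, sub_apply, inner_sub_right, InnerProductSpace.rankOne_apply,
      InnerProductSpace.rankOne_apply, inner_smul_right, inner_smul_right, map_sub,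
      inner_mul_symm_re_eq_norm, inner_mul_symm_re_eq_norm, norm_mul, norm_mul,
      norm_inner_symm b a, norm_inner_symm (𝕜 := ℂ) a b, ha, hb, inner_tensorKet, inner_tensorKet,
      inner_self_eq_norm_sq_to_K, Enc.norm_map, hw]
    simp
    ring
  rw [← h2]
  refine h1.trans ?_
  refine le_trans (le_of_eq ?_) (le_iSup_of_le 1 (le_iSup_of_le
    (InnerProductSpace.rankOne ℂ (tensorKet H 1 0 (Enc v)) (tensorKet H 1 0 (Enc v)))
    (le_iSup_of_le (traceNorm_rankOne_self_le ?_) le_rfl)))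
  · have h3 : (codeSpace Enc).starProjection (Enc v) = Enc v :=
      Submodule.starProjection_eq_self_iff.2 ⟨v, rfl⟩
    rw [tensorId_one_rankOne, LinearMap.sub_apply, map_sub, LinearMap.comp_apply,
      LinearMap.comp_apply, conjMap_rankOne, conjMap_rankOne, conjMap_rankOne, conjMap_rankOne,
      conjMap_rankOne, conjMap_rankOne, h3, logicalUnitary_apply, h]
  · rw [norm_tensorKet, Enc.norm_map, hv]

end GateError

/-! ### The characteristic function of the discrete Gaussian -/

theorem hasSum_pow_natAbs {r : ℝ} (h0 : 0 ≤ r) (h1 : r < 1) :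
    HasSum (fun k : ℤ => r ^ k.natAbs) ((1 + r) / (1 - r)) := by
  have hg := hasSum_geometric_of_lt_one h0 h1
  have h2 : HasSum (fun n : ℕ => r ^ (n : ℤ).natAbs) (1 - r)⁻¹ := by
    simpa only [Int.natAbs_natCast] using hg
  have h3 : HasSum (fun n : ℕ => r ^ (-((n : ℤ) + 1)).natAbs) (r * (1 - r)⁻¹) := by
    refine (hg.mul_left r).congr_fun fun n => ?_
    have : (-((n : ℤ) + 1)).natAbs = n + 1 := by omega
    rw [this, pow_succ']
  have h4 : (1 + r) / (1 - r) = (1 - r)⁻¹ + r * (1 - r)⁻¹ := by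
    rw [div_eq_mul_inv]
    ring
  rw [h4]
  exact HasSum.of_nat_of_neg_add_one (f := fun k : ℤ => r ^ k.natAbs) h2 h3

/-- Poisson summation for a modulated Gaussian. -/
theorem tsum_gaussian_mul_exp {κ : ℝ} (hκ : 0 < κ) (θ : ℝ) :
    ∑' z : ℤ, ((Real.exp (-κ ^ 2 * z ^ 2) : ℝ) : ℂ) * Complex.exp (Complex.I * (θ * z : ℝ)) =
      1 / ((κ ^ 2 / Real.pi : ℝ) : ℂ) ^ (1 / 2 : ℂ) *
        ((∑' k : ℤ, Real.exp (-(2 * Real.pi * k - θ) ^ 2 / (4 * κ ^ 2)) : ℝ) : ℂ) := by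
  have hπ := Real.pi_pos
  have hπ' : (Real.pi : ℂ) ≠ 0 := by exact_mod_cast hπ.ne'
  have hκ' : (κ : ℂ) ≠ 0 := by exact_mod_cast hκ.ne'
  have h := Complex.tsum_exp_neg_quadratic (a := ((κ ^ 2 / Real.pi : ℝ) : ℂ))
    (by rw [Complex.ofReal_re]; positivity) (Complex.I * θ / (2 * Real.pi))
  rw [Complex.ofReal_tsum]
  convert! h using 2
  · funext z
    push_cast
    rw [← Complex.exp_add]
    congr 1
    field_simp
  · refine tsum_congr fun k => ?_
    push_cast
    congr 1
    have hI : Complex.I * (Complex.I * θ / (2 * Real.pi)) = -(θ / (2 * Real.pi)) := by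
      rw [← mul_div_assoc, ← mul_assoc, Complex.I_mul_I]
      ring
    rw [hI]
    field_simp
    ring

/-- A summable majorant for the Poisson-dual series: a geometric series in `|k|`, corrected at `k =
0` to the exact main term. For `k ≠ 0`, `|θ| ≤ π` gives `|2πk - θ| ≥ π|k|`, and the smallness of `κ`
pushes the exponent below `-1000|k|`. -/
theorem exp_periodized_gaussian_le {κ θ : ℝ} (hκ : 0 < κ) (hκ' : κ < 1 / 250)
    (hθ : |θ| ≤ Real.pi) (k : ℤ) :
    Real.exp (-(2 * Real.pi * k - θ) ^ 2 / (4 * κ ^ 2)) ≤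
      (if k = 0 then Real.exp (-θ ^ 2 / (4 * κ ^ 2)) - 1 else 0) + (1 / 1000) ^ k.natAbs := by
  by_cases hk : k = 0
  · simp [hk]
  rw [if_neg hk, zero_add]
  have hπ := Real.pi_gt_three
  have hk1 : (1 : ℝ) ≤ |(k : ℝ)| := by
    rw [← Int.cast_abs]
    exact_mod_cast Int.one_le_abs hk
  have h1 : Real.pi * |(k : ℝ)| ≤ |2 * Real.pi * k - θ| := by
    have h2 := abs_sub_abs_le_abs_sub (2 * Real.pi * k) θ
    rw [abs_mul, abs_of_pos (by positivity : 0 < 2 * Real.pi)] at h2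
    nlinarith
  have h2 : 9 * |(k : ℝ)| ≤ (2 * Real.pi * k - θ) ^ 2 := by
    rw [← sq_abs (2 * Real.pi * k - θ)]
    have h3 : 3 * |(k : ℝ)| ≤ |2 * Real.pi * k - θ| := by nlinarith
    nlinarith
  have h4 : 1000 * |(k : ℝ)| ≤ (2 * Real.pi * k - θ) ^ 2 / (4 * κ ^ 2) := by
    rw [le_div_iff₀ (by positivity)]
    have : κ ^ 2 ≤ (1 / 250) ^ 2 := by gcongr
    nlinarith [abs_nonneg (k : ℝ)]
  have h5 : Real.exp (-1000) ≤ 1 / 1000 := by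
    rw [Real.exp_neg, inv_eq_one_div]
    gcongr
    linarith [Real.add_one_le_exp (1000 : ℝ)]
  calc Real.exp (-(2 * Real.pi * k - θ) ^ 2 / (4 * κ ^ 2))
      ≤ Real.exp (k.natAbs * (-1000)) := by
        refine Real.exp_le_exp.2 ?_
        rw [Nat.cast_natAbs, Int.cast_abs, neg_div]
        linarith
    _ = Real.exp (-1000) ^ k.natAbs := Real.exp_nat_mul _ _
    _ ≤ _ := by gcongr

theorem summable_gaussian {κ : ℝ} (hκ : 0 < κ) :
    Summable fun z : ℤ => Real.exp (-κ ^ 2 * z ^ 2) := by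
  have hπ := Real.pi_pos
  have h := summable_pow_mul_jacobiTheta₂_term_bound 0 (T := κ ^ 2 / Real.pi) (by positivity) 0
  refine h.congr fun z => ?_
  simp only [pow_zero, one_mul]
  congr 1
  field_simp
  ring

/-- The characteristic function of the discrete Gaussian is close to a Gaussian on `[-π, π]`. -/
theorem norm_tsum_gaussian_mul_exp_le {κ θ : ℝ} (hκ : 0 < κ) (hκ' : κ < 1 / 250)
    (hθ : |θ| ≤ Real.pi) :
    ‖∑' z : ℤ, ((Real.exp (-κ ^ 2 * z ^ 2) : ℝ) : ℂ) * Complex.exp (Complex.I * (θ * z : ℝ))‖ ≤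
      (Real.exp (-θ ^ 2 / (4 * κ ^ 2)) + 1 / 100) * ∑' z : ℤ, Real.exp (-κ ^ 2 * z ^ 2) := by
  have hS : ∀ {t : ℝ}, |t| ≤ Real.pi →
      Summable fun k : ℤ => Real.exp (-(2 * Real.pi * k - t) ^ 2 / (4 * κ ^ 2)) := fun {t} ht =>
    Summable.of_nonneg_of_le (fun _ => (Real.exp_pos _).le)
      (exp_periodized_gaussian_le hκ hκ' ht)
      ((hasSum_ite_eq 0 _).summable.add
        (hasSum_pow_natAbs (by norm_num) (by norm_num)).summable)
  have h0 := congrArg norm (tsum_gaussian_mul_exp hκ 0)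
  have h1 := congrArg norm (tsum_gaussian_mul_exp hκ θ)
  -- The Poisson prefactor does not depend on `θ`. Comparison with the case `θ = 0` makes it cancel,
  -- so it is never evaluated.
  set c : ℝ := ‖1 / ((κ ^ 2 / Real.pi : ℝ) : ℂ) ^ (1 / 2 : ℂ)‖ with hc
  have e0 : ∑' z : ℤ, Real.exp (-κ ^ 2 * z ^ 2) =
      c * ∑' k : ℤ, Real.exp (-(2 * Real.pi * k - 0) ^ 2 / (4 * κ ^ 2)) := by
    rw [norm_mul, ← hc, Complex.norm_real,
      Real.norm_of_nonneg (tsum_nonneg fun _ => (Real.exp_pos _).le)] at h0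
    rw [← h0]
    simp only [zero_mul, Complex.ofReal_zero, mul_zero, Complex.exp_zero, mul_one]
    rw [← Complex.ofReal_tsum, Complex.norm_real,
      Real.norm_of_nonneg (tsum_nonneg fun _ => (Real.exp_pos _).le)]
  rw [norm_mul, ← hc, Complex.norm_real,
    Real.norm_of_nonneg (tsum_nonneg fun _ => (Real.exp_pos _).le)] at h1
  have hc0 : 0 ≤ c := norm_nonneg _
  -- The term `k = 0` alone is 1.
  have h2 : 1 ≤ ∑' k : ℤ, Real.exp (-(2 * Real.pi * k - 0) ^ 2 / (4 * κ ^ 2)) := by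
    refine le_trans (by simp) ((hS (by simpa using Real.pi_pos.le)).le_tsum 0
      fun _ _ => (Real.exp_pos _).le)
  have h3 : ∑' k : ℤ, Real.exp (-(2 * Real.pi * k - θ) ^ 2 / (4 * κ ^ 2)) ≤
      Real.exp (-θ ^ 2 / (4 * κ ^ 2)) + 1 / 100 := by
    have h4 := (hasSum_ite_eq (0 : ℤ) (Real.exp (-θ ^ 2 / (4 * κ ^ 2)) - 1)).add
      (hasSum_pow_natAbs (r := 1 / 1000) (by norm_num) (by norm_num))
    refine ((hS hθ).tsum_le_tsum (exp_periodized_gaussian_le hκ hκ' hθ) h4.summable).trans ?_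
    -- The majorant sums to the main term plus `(1 + r)/(1 - r) - 1 = 2/999` with `r = 1/1000`.
    rw [h4.tsum_eq]
    norm_num
    linarith
  rw [h1, e0]
  have h5 : 0 ≤ Real.exp (-θ ^ 2 / (4 * κ ^ 2)) + 1 / 100 := by positivity
  calc _ ≤ c * (Real.exp (-θ ^ 2 / (4 * κ ^ 2)) + 1 / 100) := by gcongr
    _ = (Real.exp (-θ ^ 2 / (4 * κ ^ 2)) + 1 / 100) * (c * 1) := by ring
    _ ≤ _ := by gcongr

/-! ### Commutation rules for phases, translations and squeezing -/

theorem phaseUnitary_coeFn (θ : ℝ → ℝ) (hθ : Continuous θ) (f : L2R) :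
    ∀ᵐ x : ℝ, phaseUnitary θ hθ f x = Complex.exp (Complex.I * θ x) * f x :=
  (memLp_phase θ hθ f).coeFn_toLp

theorem translation_coeFn (s : ℝ) (f : L2R) : ∀ᵐ x : ℝ, translation s f x = f (x - s) :=
  Lp.coeFn_compMeasurePreserving f (measurePreserving_sub_right volume s)

theorem squeezing_coeFn (α : ℝ) (hα : 0 < α) (f : L2R) :
    ∀ᵐ x : ℝ, squeezing α hα f x = ((1 / √α : ℝ) : ℂ) * f (x / α) :=
  (memLp_squeeze α hα f).coeFn_toLp

theorem translation_zero_apply (f : L2R) : translation 0 f = f := by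
  refine Lp.ext ?_
  filter_upwards [translation_coeFn 0 f] with x hx
  rw [hx, sub_zero]

theorem phaseUnitary_squeezing (θ : ℝ → ℝ) (hθ : Continuous θ) (α : ℝ) (hα : 0 < α) (f : L2R) :
    phaseUnitary θ hθ (squeezing α hα f) =
      squeezing α hα (phaseUnitary (fun x => θ (α * x)) (by fun_prop) f) := by
  refine Lp.ext ?_
  filter_upwards [phaseUnitary_coeFn θ hθ (squeezing α hα f), squeezing_coeFn α hα f,
    squeezing_coeFn α hα (phaseUnitary (fun x => θ (α * x)) (by fun_prop) f),
    (quasiMeasurePreserving_div α hα).ae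
      (phaseUnitary_coeFn (fun x => θ (α * x)) (by fun_prop) f)] with x h1 h2 h3 h4
  rw [h1, h2, h3, h4, mul_div_cancel₀ _ hα.ne']
  ring

theorem phaseUnitary_translation (θ : ℝ → ℝ) (hθ : Continuous θ) (s : ℝ) (f : L2R) :
    phaseUnitary θ hθ (translation s f) =
      translation s (phaseUnitary (fun x => θ (x + s)) (by fun_prop) f) := by
  refine Lp.ext ?_
  filter_upwards [phaseUnitary_coeFn θ hθ (translation s f), translation_coeFn s f,
    translation_coeFn s (phaseUnitary (fun x => θ (x + s)) (by fun_prop) f),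
    (measurePreserving_sub_right volume s).quasiMeasurePreserving.ae
      (phaseUnitary_coeFn (fun x => θ (x + s)) (by fun_prop) f)] with x h1 h2 h3 h4
  rw [h1, h2, h3, h4, sub_add_cancel]

theorem inner_phaseUnitary_self (θ : ℝ → ℝ) (hθ : Continuous θ) (f : L2R) :
    ⟪f, phaseUnitary θ hθ f⟫_ℂ = ∫ x, ((‖f x‖ ^ 2 : ℝ) : ℂ) * Complex.exp (Complex.I * θ x) := by
  rw [L2.inner_def]
  refine integral_congr_ae ?_
  filter_upwards [phaseUnitary_coeFn θ hθ f] with x hx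
  rw [hx, RCLike.inner_apply, mul_assoc, RCLike.mul_conj, mul_comm]
  simp

theorem integrable_norm_sq (f : L2R) : Integrable fun x => ‖f x‖ ^ 2 :=
  (memLp_two_iff_integrable_sq_norm (Lp.aestronglyMeasurable f)).1 (Lp.memLp f)

theorem integral_norm_sq (f : L2R) : ∫ x, ‖f x‖ ^ 2 = ‖f‖ ^ 2 := by
  have h : ⟪f, f⟫_ℂ = ((∫ x, ‖f x‖ ^ 2 : ℝ) : ℂ) := by
    rw [L2.inner_def, ← integral_complex_ofReal]
    refine integral_congr_ae (Eventually.of_forall fun x => ?_)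
    simp only [inner_self_eq_norm_sq_to_K]
    simp
  rw [inner_self_eq_norm_sq_to_K] at h
  refine Complex.ofReal_injective (h.symm.trans ?_)
  simp

/-- Only cross terms between different indices need to vanish, so the lemma applies to the peaks and
their images under a phase. -/
theorem inner_tsum_tsum_of_orthogonal {ι : Type*} {f g : ι → L2R} (hf : Summable f)
    (hg : Summable g) (h : ∀ i j, i ≠ j → ⟪f i, g j⟫_ℂ = 0) :
    ⟪∑' i, f i, ∑' i, g i⟫_ℂ = ∑' i, ⟪f i, g i⟫_ℂ := by
  rw [inner_tsum_right hg]
  refine tsum_congr fun j => ?_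
  rw [← inner_conj_symm, inner_tsum_right hf, tsum_eq_single j, inner_conj_symm]
  intro i hi
  rw [← inner_conj_symm, h i j hi, map_zero]

/-! ### The truncated Gaussian peak -/

theorem gkpPeak_sq {Δ : ℝ} (hΔ : 0 < Δ) (x : ℝ) :
    gkpPeak Δ x ^ 2 = 1 / (√Real.pi * Δ) * Real.exp (-(1 / Δ ^ 2) * x ^ 2) := by
  have hπ := Real.pi_pos
  have h : (Real.pi ^ (1 / 4 : ℝ)) ^ 2 = √Real.pi := by
    rw [← Real.rpow_natCast, ← Real.rpow_mul hπ.le, Real.sqrt_eq_rpow]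
    norm_num
  unfold gkpPeak
  rw [mul_pow, div_pow, mul_pow, Real.sq_sqrt hΔ.le, h, one_pow, ← Real.exp_nat_mul]
  congr 2
  push_cast
  field_simp

theorem cutPeak_norm_sq {Δ ε : ℝ} (hΔ : 0 < Δ) :
    ∀ᵐ x : ℝ, ‖cutPeak Δ ε x‖ ^ 2 = (Set.Icc (-ε) ε).indicator
      (fun x => 1 / (√Real.pi * Δ) * Real.exp (-(1 / Δ ^ 2) * x ^ 2)) x := by
  filter_upwards [(memLp_cutPeak Δ ε).coeFn_toLp] with x hx
  have hx' : cutPeak Δ ε x = (Set.Icc (-ε) ε).indicator (fun x : ℝ => (gkpPeak Δ x : ℂ)) x := hx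
  rw [hx']
  by_cases h : x ∈ Set.Icc (-ε) ε
  · rw [Set.indicator_of_mem h, Set.indicator_of_mem h, Complex.norm_real, Real.norm_eq_abs,
      sq_abs, gkpPeak_sq hΔ]
  · simp [Set.indicator_of_notMem h]

/-- Outside `[-ε, ε]` the density is the square of `exp(-x²/(2Δ²))`, and one of the two factors is
at most `1/401` because `x²/(2Δ²) ≥ 400`. The lost mass is then at most `√2/401`. -/
theorem cutPeak_norm_sq_ge {Δ ε : ℝ} (hΔ : 0 < Δ) (hε : 0 < ε) (h : 800 * Δ ^ 2 ≤ ε ^ 2) :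
    99 / 100 ≤ ‖cutPeak Δ ε‖ ^ 2 := by
  have hπ := Real.pi_pos
  set c := 1 / (√Real.pi * Δ) with hc
  have hc0 : 0 < c := by positivity
  have hi1 := integrable_exp_neg_mul_sq (b := 1 / Δ ^ 2) (by positivity)
  have hi2 := integrable_exp_neg_mul_sq (b := 1 / (2 * Δ ^ 2)) (by positivity)
  rw [← integral_norm_sq]
  have hle : ∫ x, (c * Real.exp (-(1 / Δ ^ 2) * x ^ 2) -
      c * (1 / 401) * Real.exp (-(1 / (2 * Δ ^ 2)) * x ^ 2)) ≤ ∫ x, ‖cutPeak Δ ε x‖ ^ 2 := by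
    refine integral_mono_ae ((hi1.const_mul _).sub (hi2.const_mul _)) (integrable_norm_sq _) ?_
    filter_upwards [cutPeak_norm_sq (ε := ε) hΔ] with x hx
    rw [hx]
    by_cases hxe : x ∈ Set.Icc (-ε) ε
    · rw [Set.indicator_of_mem hxe]
      have : 0 ≤ c * (1 / 401) * Real.exp (-(1 / (2 * Δ ^ 2)) * x ^ 2) := by positivity
      linarith
    · rw [Set.indicator_of_notMem hxe]
      have h1 : ε ^ 2 ≤ x ^ 2 := by
        rw [sq_le_sq, abs_of_pos hε]
        by_contra hlt
        exact hxe (abs_le.1 (not_le.1 hlt).le)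
      have h2 : 400 ≤ 1 / (2 * Δ ^ 2) * x ^ 2 := by
        rw [one_div_mul_eq_div, le_div_iff₀ (by positivity)]
        linarith
      have h3 : Real.exp (-(1 / (2 * Δ ^ 2)) * x ^ 2) ≤ 1 / 401 := by
        rw [neg_mul, Real.exp_neg, inv_eq_one_div]
        gcongr
        linarith [Real.add_one_le_exp (1 / (2 * Δ ^ 2) * x ^ 2)]
      have h4 : Real.exp (-(1 / Δ ^ 2) * x ^ 2) = Real.exp (-(1 / (2 * Δ ^ 2)) * x ^ 2) *
          Real.exp (-(1 / (2 * Δ ^ 2)) * x ^ 2) := by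
        rw [← Real.exp_add]
        congr 1
        field_simp
        ring
      rw [h4, sub_nonpos, mul_assoc]
      gcongr
  refine le_trans ?_ hle
  rw [integral_sub (hi1.const_mul _) (hi2.const_mul _), integral_const_mul, integral_const_mul,
    integral_gaussian, integral_gaussian]
  have e1 : √(Real.pi / (1 / Δ ^ 2)) = √Real.pi * Δ := by
    rw [div_div_eq_mul_div, div_one, Real.sqrt_mul hπ.le, Real.sqrt_sq hΔ.le]
  have e2 : √(Real.pi / (1 / (2 * Δ ^ 2))) = √2 * (√Real.pi * Δ) := by
    rw [div_div_eq_mul_div, div_one, Real.sqrt_mul hπ.le, Real.sqrt_mul (by norm_num),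
      Real.sqrt_sq hΔ.le]
    ring
  have h2 : √2 ≤ 2 := by
    rw [Real.sqrt_le_left (by norm_num)]
    norm_num
  rw [e1, e2]
  have e3 : c * (√Real.pi * Δ) = 1 := by
    rw [hc]
    field_simp
  have e4 : c * (1 / 401) * (√2 * (√Real.pi * Δ)) = √2 / 401 := by
    rw [← mul_div_assoc, mul_one, div_mul_eq_mul_div, mul_left_comm, e3, mul_one]
  rw [e3, e4]
  linarith

/-- Dropping the cutoff only increases the integral. The exponents add up to `5/(4Δ²)`, so the full
Gaussian integral is `√(4/5)`. That this is a constant below 1, whatever `Δ`, is the source of the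
no-go result. -/
theorem integral_cutPeak_norm_sq_mul_exp_le {Δ ε : ℝ} (hΔ : 0 < Δ) :
    ∫ x, ‖cutPeak Δ ε x‖ ^ 2 * Real.exp (-(1 / (4 * Δ ^ 2)) * x ^ 2) ≤ 9 / 10 := by
  have hπ := Real.pi_pos
  set c := 1 / (√Real.pi * Δ) with hc
  have hc0 : 0 < c := by positivity
  have hi1 := integrable_exp_neg_mul_sq (b := 5 / (4 * Δ ^ 2)) (by positivity)
  have hle : ∫ x, ‖cutPeak Δ ε x‖ ^ 2 * Real.exp (-(1 / (4 * Δ ^ 2)) * x ^ 2) ≤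
      ∫ x, c * Real.exp (-(5 / (4 * Δ ^ 2)) * x ^ 2) := by
    refine integral_mono_of_nonneg (Eventually.of_forall fun x => by positivity)
      (hi1.const_mul _) ?_
    filter_upwards [cutPeak_norm_sq (ε := ε) hΔ] with x hx
    have h1 : ‖cutPeak Δ ε x‖ ^ 2 ≤ c * Real.exp (-(1 / Δ ^ 2) * x ^ 2) := by
      rw [hx]
      exact Set.indicator_le_self' (fun _ _ => by positivity) x
    calc _ ≤ c * Real.exp (-(1 / Δ ^ 2) * x ^ 2) * Real.exp (-(1 / (4 * Δ ^ 2)) * x ^ 2) := by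
          gcongr
      _ = _ := by
          rw [mul_assoc, ← Real.exp_add]
          congr 2
          field_simp
          ring
  refine hle.trans ?_
  rw [integral_const_mul, integral_gaussian]
  have e1 : √(Real.pi / (5 / (4 * Δ ^ 2))) = √(4 / 5) * (√Real.pi * Δ) := by
    rw [show Real.pi / (5 / (4 * Δ ^ 2)) = 4 / 5 * (Real.pi * Δ ^ 2) by field_simp,
      Real.sqrt_mul (by norm_num), Real.sqrt_mul hπ.le, Real.sqrt_sq hΔ.le]
  have e3 : c * (√Real.pi * Δ) = 1 := by
    rw [hc]
    field_simp
  rw [e1, mul_left_comm, e3, mul_one, Real.sqrt_le_left (by norm_num)]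
  norm_num

/-! ### The overlap of a code state with its image under a quadratic phase -/

theorem gkpEnvelope_sq {κ : ℝ} (hκ : 0 < κ) (x : ℝ) :
    gkpEnvelope κ x ^ 2 = κ / √Real.pi * Real.exp (-κ ^ 2 * x ^ 2) := by
  have hπ := Real.pi_pos
  have h : (Real.pi ^ (1 / 4 : ℝ)) ^ 2 = √Real.pi := by
    rw [← Real.rpow_natCast, ← Real.rpow_mul hπ.le, Real.sqrt_eq_rpow]
    norm_num
  unfold gkpEnvelope
  rw [mul_pow, div_pow, Real.sq_sqrt hκ.le, h, ← Real.exp_nat_mul]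
  congr 2
  push_cast
  ring

theorem norm_tsum_gkpEnvelope_sq_mul_exp_le {κ θ : ℝ} (hκ : 0 < κ) (hκ' : κ < 1 / 250)
    (hθ : |θ| ≤ Real.pi) :
    ‖∑' z : ℤ, ((gkpEnvelope κ z ^ 2 : ℝ) : ℂ) * Complex.exp (Complex.I * (θ * z : ℝ))‖ ≤
      (Real.exp (-θ ^ 2 / (4 * κ ^ 2)) + 1 / 100) * ∑' z : ℤ, gkpEnvelope κ z ^ 2 := by
  have hc : 0 ≤ κ / √Real.pi := by positivity
  simp only [gkpEnvelope_sq hκ, Complex.ofReal_mul _ (Real.exp _), mul_assoc]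
  rw [tsum_mul_left, tsum_mul_left, norm_mul, Complex.norm_real, Real.norm_of_nonneg hc,
    mul_left_comm]
  exact mul_le_mul_of_nonneg_left (norm_tsum_gaussian_mul_exp_le hκ hκ' hθ) hc

theorem summable_gkpEnvelope_sq {κ : ℝ} (hκ : 0 < κ) :
    Summable fun z : ℤ => gkpEnvelope κ z ^ 2 := by
  simp only [gkpEnvelope_sq hκ]
  exact (summable_gaussian hκ).mul_left _

/-- A phase is a multiplication operator and does not enlarge supports; for `ε ≤ 1/2` the supports
of distinct peaks meet at most in an endpoint. -/
theorem inner_truncPeak_of_ne {Δ ε : ℝ} (hε : ε ≤ 1 / 2) {φ : ℝ → ℝ} (hφ : Continuous φ)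
    {z w : ℤ} (hzw : z ≠ w) : ⟪truncPeak Δ ε z, phaseUnitary φ hφ (truncPeak Δ ε w)⟫_ℂ = 0 := by
  refine inner_eq_zero_of_ae_zero (ae_zero_truncPeak Δ ε z)
    (a' := -ε + w) (b' := ε + w) ?_ ?_
  · filter_upwards [ae_zero_truncPeak Δ ε w, phaseUnitary_coeFn φ hφ (truncPeak Δ ε w)]
      with x h1 h2 hx
    rw [h2, h1 hx, mul_zero]
  · rcases lt_or_gt_of_ne hzw with h | h
    · have : (z : ℝ) + 1 ≤ w := by exact_mod_cast h
      left
      linarith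
    · have : (w : ℝ) + 1 ≤ z := by exact_mod_cast h
      right
      linarith

theorem inner_phaseUnitary_tsum_truncPeak {κ Δ ε : ℝ} (hκ : 0 < κ) (hΔ : 0 < Δ) (hε : 0 < ε)
    (hε2 : ε ≤ 1 / 2) {φ : ℝ → ℝ} (hφ : Continuous φ) :
    ⟪∑' z : ℤ, ((gkpEnvelope κ z : ℝ) : ℂ) • truncPeak Δ ε z,
      phaseUnitary φ hφ (∑' z : ℤ, ((gkpEnvelope κ z : ℝ) : ℂ) • truncPeak Δ ε z)⟫_ℂ =
    ∑' z : ℤ, ((gkpEnvelope κ z ^ 2 : ℝ) : ℂ) *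
      ∫ x, ((‖normalized (cutPeak Δ ε) x‖ ^ 2 : ℝ) : ℂ) * Complex.exp (Complex.I * φ (x + z)) := by
  have hs := summable_gkp hκ hΔ hε
  have hs' : Summable fun z : ℤ =>
      phaseUnitary φ hφ (((gkpEnvelope κ z : ℝ) : ℂ) • truncPeak Δ ε z) :=
    ((phaseUnitary φ hφ : L2R ≃L[ℂ] L2R) : L2R →L[ℂ] L2R).summable hs
  have h1 : phaseUnitary φ hφ (∑' z : ℤ, ((gkpEnvelope κ z : ℝ) : ℂ) • truncPeak Δ ε z) =
      ∑' z : ℤ, phaseUnitary φ hφ (((gkpEnvelope κ z : ℝ) : ℂ) • truncPeak Δ ε z) :=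
    ((phaseUnitary φ hφ : L2R ≃L[ℂ] L2R) : L2R →L[ℂ] L2R).map_tsum hs
  rw [h1, inner_tsum_tsum_of_orthogonal hs hs']
  · refine tsum_congr fun z => ?_
    rw [map_smul, inner_smul_left, inner_smul_right, Complex.conj_ofReal, ← mul_assoc,
      truncPeak, phaseUnitary_translation, LinearIsometry.inner_map_map, inner_phaseUnitary_self]
    push_cast
    rw [sq]
  · intro z w hzw
    rw [map_smul, inner_smul_left, inner_smul_right, inner_truncPeak_of_ne hε2 hφ hzw, mul_zero,
      mul_zero]

theorem norm_sq_tsum_truncPeak {κ Δ ε : ℝ} (hκ : 0 < κ) (hΔ : 0 < Δ) (hε : 0 < ε)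
    (hε2 : ε ≤ 1 / 2) :
    ‖∑' z : ℤ, ((gkpEnvelope κ z : ℝ) : ℂ) • truncPeak Δ ε z‖ ^ 2 =
      ∑' z : ℤ, gkpEnvelope κ z ^ 2 := by
  -- The trivial phase turns the overlap formula into a norm formula.
  have h := inner_phaseUnitary_tsum_truncPeak hκ hΔ hε hε2 (φ := fun _ => 0) continuous_const
  have h0 : ∀ f : L2R, phaseUnitary (fun _ => 0) continuous_const f = f := fun f => by
    refine Lp.ext ?_
    filter_upwards [phaseUnitary_coeFn (fun _ => 0) continuous_const f] with x hx
    simp [hx]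
  rw [h0, inner_self_eq_norm_sq_to_K] at h
  simp only [Complex.ofReal_zero, mul_zero, Complex.exp_zero, mul_one] at h
  rw [integral_complex_ofReal, integral_norm_sq, norm_normalized (cutPeak_ne_zero hΔ hε), one_pow,
    Complex.ofReal_one] at h
  simp only [mul_one] at h
  rw [← Complex.ofReal_tsum] at h
  refine Complex.ofReal_injective (Eq.trans ?_ h)
  simp

theorem normalized_norm_sq {Δ ε : ℝ} :
    ∀ᵐ x : ℝ, ‖normalized (cutPeak Δ ε) x‖ ^ 2 = (‖cutPeak Δ ε‖ ^ 2)⁻¹ * ‖cutPeak Δ ε x‖ ^ 2 := by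
  filter_upwards [Lp.coeFn_smul ((‖cutPeak Δ ε‖⁻¹ : ℝ) : ℂ) (cutPeak Δ ε)] with x h1
  have h3 : normalized (cutPeak Δ ε) x = ((‖cutPeak Δ ε‖⁻¹ : ℝ) : ℂ) • cutPeak Δ ε x := h1
  rw [h3, norm_smul, Complex.norm_real, norm_inv, norm_norm, mul_pow, inv_pow]

theorem integral_normalized_norm_sq_mul_le {d κ Δ ε : ℝ} (hκ : 0 < κ) (hΔ : 0 < Δ)
    (hε : 0 < ε) (hκΔ : 1 ≤ 2 * Real.pi * d * Δ / κ) (h : 800 * Δ ^ 2 ≤ ε ^ 2) :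
    ∫ x, ‖normalized (cutPeak Δ ε) x‖ ^ 2 *
      (Real.exp (-(2 * Real.pi * d * x) ^ 2 / (4 * κ ^ 2)) + 1 / 100) ≤ 93 / 100 := by
  have hπ := Real.pi_pos
  have hN := cutPeak_norm_sq_ge hΔ hε h
  have hint : Integrable fun x => ‖cutPeak Δ ε x‖ ^ 2 * Real.exp (-(1 / (4 * Δ ^ 2)) * x ^ 2) := by
    refine (integrable_norm_sq (cutPeak Δ ε)).mul_bdd (c := 1) (by fun_prop) ?_
    refine Eventually.of_forall fun x => ?_
    rw [Real.norm_of_nonneg (Real.exp_pos _).le, Real.exp_le_one_iff, neg_mul, neg_nonpos]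
    positivity
  calc _ ≤ ∫ x, ((‖cutPeak Δ ε‖ ^ 2)⁻¹ *
        (‖cutPeak Δ ε x‖ ^ 2 * Real.exp (-(1 / (4 * Δ ^ 2)) * x ^ 2)) +
          ‖normalized (cutPeak Δ ε) x‖ ^ 2 * (1 / 100)) := by
        refine integral_mono_of_nonneg (Eventually.of_forall fun x => by positivity)
          ((hint.const_mul _).add ((integrable_norm_sq _).mul_const _)) ?_
        filter_upwards [normalized_norm_sq (Δ := Δ) (ε := ε)] with x hx
        rw [mul_add, hx, ← mul_assoc ((‖cutPeak Δ ε‖ ^ 2)⁻¹)]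
        gcongr
        rw [neg_div, neg_mul, neg_le_neg_iff, mul_pow, one_div_mul_eq_div,
          div_le_div_iff₀ (by positivity) (by positivity)]
        -- The assumption linking `Δ` and `κ` enters here: it replaces the decay scale set by `κ`
        -- with one set by `Δ`.
        have h1 : κ ≤ 2 * Real.pi * d * Δ := by rwa [one_le_div hκ] at hκΔ
        have h2 : κ ^ 2 ≤ (2 * Real.pi * d * Δ) ^ 2 := by gcongr
        nlinarith [mul_le_mul_of_nonneg_left h2 (sq_nonneg x)]
    _ ≤ (99 / 100)⁻¹ * (9 / 10) + 1 / 100 := by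
        rw [integral_add (hint.const_mul _) ((integrable_norm_sq _).mul_const _),
          integral_const_mul, integral_mul_const, integral_norm_sq,
          norm_normalized (cutPeak_ne_zero hΔ hε), one_pow, one_mul]
        gcongr
        exact integral_cutPeak_norm_sq_mul_exp_le hΔ
    _ ≤ 93 / 100 := by norm_num

/-- `hper` isolates the only property of the quadratic phase that matters: an integer shift by `z`
multiplies it by a character of `z` whose frequency is proportional to the offset `x`. -/
theorem norm_inner_phaseUnitary_gkpState_le {d κ Δ ε : ℝ} (hd : 1 ≤ d) (hκ : 0 < κ)
    (hκ' : κ < 1 / 250) (hΔ : 0 < Δ) (hε : 0 < ε) (hεd : ε ≤ 1 / (2 * d))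
    (hκΔ : 1 ≤ 2 * Real.pi * d * Δ / κ) (h : 800 * Δ ^ 2 ≤ ε ^ 2) {φ : ℝ → ℝ} (hφ : Continuous φ)
    (hper : ∀ (x : ℝ) (z : ℤ), Complex.exp (Complex.I * φ (x + z)) =
      Complex.exp (Complex.I * φ x) * Complex.exp (Complex.I * (2 * Real.pi * d * x * z : ℝ))) :
    ‖⟪gkpState κ Δ ε, phaseUnitary φ hφ (gkpState κ Δ ε)⟫_ℂ‖ ≤ 93 / 100 := by
  have hπ := Real.pi_pos
  have hd0 : 0 < d := by linarith
  have hε2 : ε ≤ 1 / 2 := hεd.trans (by gcongr; linarith)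
  set G := ∑' z : ℤ, ((gkpEnvelope κ z : ℝ) : ℂ) • truncPeak Δ ε z with hG
  have hG0 : 0 < ‖G‖ := norm_pos_iff.2 (gkpSum_ne_zero hκ hΔ hε hε2)
  have hGsq := norm_sq_tsum_truncPeak hκ hΔ hε hε2
  rw [← hG] at hGsq
  set q : ℝ → ℝ := fun x => ‖normalized (cutPeak Δ ε) x‖ ^ 2 with hq
  have hqi : Integrable q := integrable_norm_sq _
  have hexp : ∀ t : ℝ, ‖Complex.exp (Complex.I * t)‖ = 1 := fun t => by
    rw [mul_comm, Complex.norm_exp_ofReal_mul_I]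
  have hq1 : ∫ x, q x = 1 := by
    rw [hq, integral_norm_sq, norm_normalized (cutPeak_ne_zero hΔ hε), one_pow]
  have hinner := inner_phaseUnitary_tsum_truncPeak hκ hΔ hε hε2 hφ
  rw [← hG] at hinner
  set F : ℤ → ℝ → ℂ := fun z x => ((gkpEnvelope κ z ^ 2 : ℝ) : ℂ) *
    (((q x : ℝ) : ℂ) * Complex.exp (Complex.I * φ (x + z))) with hF
  have hFn : ∀ z x, ‖F z x‖ = gkpEnvelope κ z ^ 2 * q x := fun z x => by
    rw [hF]
    simp only
    rw [norm_mul, norm_mul, hexp, mul_one, Complex.norm_real, Complex.norm_real,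
      Real.norm_of_nonneg (sq_nonneg _), Real.norm_of_nonneg (sq_nonneg _)]
  have hFi : ∀ z, Integrable (F z) := fun z => by
    refine Integrable.const_mul ?_ _
    refine hqi.ofReal.mul_bdd (c := 1) (by fun_prop) ?_
    exact Eventually.of_forall fun x => (hexp _).le
  -- Exchanging sum and integral allows the sum over `z` to be estimated at each fixed offset `x`;
  -- the norms integrate to the summable `η_κ(z)²`.
  have hswap := integral_tsum_of_summable_integral_norm hFi (by
    simp only [hFn, integral_const_mul, hq1, mul_one]
    exact summable_gkpEnvelope_sq hκ)
  have hle : ‖∫ x, ∑' z, F z x‖ ≤ 93 / 100 * ‖G‖ ^ 2 := by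
    refine (norm_integral_le_of_norm_le (g := fun x => q x *
      (Real.exp (-(2 * Real.pi * d * x) ^ 2 / (4 * κ ^ 2)) + 1 / 100) * ‖G‖ ^ 2) ?_ ?_).trans ?_
    · refine Integrable.mul_const ?_ _
      refine hqi.mul_bdd (c := 2) (by fun_prop) (Eventually.of_forall fun x => ?_)
      rw [Real.norm_of_nonneg (by positivity)]
      have : Real.exp (-(2 * Real.pi * d * x) ^ 2 / (4 * κ ^ 2)) ≤ 1 := by
        rw [Real.exp_le_one_iff, neg_div, neg_nonpos]
        positivity
      linarith
    · filter_upwards [normalized_norm_sq (Δ := Δ) (ε := ε), cutPeak_norm_sq (ε := ε) hΔ]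
        with x h1 h2
      by_cases hx : x ∈ Set.Icc (-ε) ε
      -- The truncation `ε ≤ 1/(2d)` is exactly what keeps the frequency in `[-π, π]`, where the
      -- characteristic function bound applies.
      · have hθ : |2 * Real.pi * d * x| ≤ Real.pi := by
          rw [abs_mul, abs_of_pos (by positivity : 0 < 2 * Real.pi * d)]
          have h3 : |x| ≤ 1 / (2 * d) := (abs_le.2 hx).trans hεd
          calc 2 * Real.pi * d * |x| ≤ 2 * Real.pi * d * (1 / (2 * d)) := by gcongr
            _ = Real.pi := by field_simp
        have h4 : ∑' z, F z x = ((q x : ℝ) : ℂ) * Complex.exp (Complex.I * φ x) *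
            ∑' z : ℤ, ((gkpEnvelope κ z ^ 2 : ℝ) : ℂ) *
              Complex.exp (Complex.I * (2 * Real.pi * d * x * z : ℝ)) := by
          rw [← tsum_mul_left]
          refine tsum_congr fun z => ?_
          simp only [hF, hper]
          ring
        rw [h4, norm_mul, norm_mul, hexp, mul_one, Complex.norm_real,
          Real.norm_of_nonneg (sq_nonneg _), hGsq, mul_assoc (q x)]
        exact mul_le_mul_of_nonneg_left (norm_tsum_gkpEnvelope_sq_mul_exp_le hκ hκ' hθ)
          (sq_nonneg _)
      · have h3 : q x = 0 := by
          simp only [hq]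
          rw [h1, h2, Set.indicator_of_notMem hx, mul_zero]
        simp [hF, h3]
    · rw [integral_mul_const]
      gcongr
      exact integral_normalized_norm_sq_mul_le hκ hΔ hε hκΔ h
  have hval : ⟪G, phaseUnitary φ hφ G⟫_ℂ = ∫ x, ∑' z, F z x := by
    rw [hinner, ← hswap]
    refine tsum_congr fun z => ?_
    rw [hF, integral_const_mul]
  have hst : gkpState κ Δ ε = ((‖G‖⁻¹ : ℝ) : ℂ) • G := rfl
  rw [hst, map_smul, inner_smul_left, inner_smul_right, Complex.conj_ofReal, norm_mul, norm_mul,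
    Complex.norm_real, norm_inv, norm_norm, hval]
  calc ‖G‖⁻¹ * (‖G‖⁻¹ * ‖∫ x, ∑' z, F z x‖) ≤ ‖G‖⁻¹ * (‖G‖⁻¹ * (93 / 100 * ‖G‖ ^ 2)) := by gcongr
    _ = 93 / 100 := by field_simp

/-! ### The standard implementation of the phase gate -/

/-- For odd `d` the expression has the parity of `z² + z`. This is why the linear term with `c_d` is
present: it makes the phase at integer points a multiple of `2π`. -/
theorem even_mul_mul_add_parity (d : ℕ) (z : ℤ) :
    Even ((d : ℤ) * z ^ 2 + ((d % 2 : ℕ) : ℤ) * z) := by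
  rcases Nat.mod_two_eq_zero_or_one d with h | h
  · have : Even (d : ℤ) := by exact_mod_cast Nat.even_iff.2 h
    simp [h, this.mul_right]
  · have : Odd (d : ℤ) := by exact_mod_cast Nat.odd_iff.2 h
    simp only [h, Nat.cast_one, one_mul]
    rcases Int.even_or_odd z with hz | hz
    · exact ((hz.pow_of_ne_zero two_ne_zero).mul_left _).add hz
    · exact (this.mul hz.pow).add_odd hz

theorem gkpEncoder_single (d : ℕ) (hd : 0 < d) {κ Δ ε : ℝ} (hκ : 0 < κ) (hΔ : 0 < Δ)
    (hε : 0 < ε) (hεd : ε ≤ 1 / (2 * d)) (j : Fin d) :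
    gkpEncoder d hd κ Δ ε hκ hΔ hε hεd (EuclideanSpace.single j 1) = gkpCodeState d hd κ Δ ε j := by
  rw [← EuclideanSpace.basisFun_apply, ← OrthonormalBasis.coe_toBasis]
  exact Module.Basis.constr_basis _ _ _ _

theorem phaseGate_single_zero (d : ℕ) (hd : 0 < d) :
    Matrix.toEuclideanCLM (n := Fin d) (𝕜 := ℂ) (phaseGate d : Matrix (Fin d) (Fin d) ℂ)
      (EuclideanSpace.single ⟨0, hd⟩ 1) = EuclideanSpace.single ⟨0, hd⟩ 1 := by
  ext i
  by_cases hi : i = ⟨0, hd⟩ <;> simp [phaseGate, Matrix.mulVec_diagonal, hi]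

theorem norm_inner_phaseImplementation_le (d : ℕ) (hd : 0 < d) {κ Δ ε : ℝ} (hκ : 0 < κ)
    (hκ' : κ < 1 / 250) (hΔ : 0 < Δ) (hε : 0 < ε) (hεd : ε ≤ 1 / (2 * d))
    (hκΔ : 1 ≤ 2 * Real.pi * d * Δ / κ) (h : 800 * Δ ^ 2 ≤ ε ^ 2) :
    ‖⟪gkpCodeState d hd κ Δ ε ⟨0, hd⟩,
      phaseImplementation d (gkpCodeState d hd κ Δ ε ⟨0, hd⟩)⟫_ℂ‖ ≤ 93 / 100 := by
  have hπ := Real.pi_pos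
  have hd1 : (1 : ℝ) ≤ d := by exact_mod_cast hd
  have hα : 0 < √(2 * Real.pi * d) := by positivity
  have h0 : gkpCodeState d hd κ Δ ε ⟨0, hd⟩ =
      squeezing (√(2 * Real.pi * d)) hα (gkpState κ Δ ε) := by
    simp only [gkpCodeState, Nat.cast_zero, zero_mul, translation_zero_apply]
  rw [h0, phaseImplementation, phaseUnitary_squeezing, LinearIsometry.inner_map_map]
  refine norm_inner_phaseUnitary_gkpState_le hd1 hκ hκ' hΔ hε hεd hκΔ h _ fun x z => ?_
  obtain ⟨m, hm⟩ := even_mul_mul_add_parity d z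
  have hm' : (d : ℝ) * z ^ 2 + parityConst d * z = m + m := by
    have := congrArg (Int.cast (R := ℝ)) hm
    simpa only [parityConst, Int.cast_add, Int.cast_mul, Int.cast_pow,
      Int.cast_natCast] using this
  have hα2 : √(2 * Real.pi * d) ^ 2 = 2 * Real.pi * d := Real.sq_sqrt (by positivity)
  have hαs : √(2 * Real.pi / d) * √(2 * Real.pi * d) = 2 * Real.pi := by
    rw [← Real.sqrt_mul (by positivity),
      show 2 * Real.pi / d * (2 * Real.pi * d) = (2 * Real.pi) ^ 2 by field_simp,
      Real.sqrt_sq (by positivity)]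
  have key : ∀ y : ℝ, ((√(2 * Real.pi * d) * y) ^ 2 +
      parityConst d * √(2 * Real.pi / d) * (√(2 * Real.pi * d) * y)) / 2 =
      Real.pi * (d * y ^ 2 + parityConst d * y) := fun y => by
    rw [mul_pow, hα2, show parityConst d * √(2 * Real.pi / d) * (√(2 * Real.pi * d) * y) =
      parityConst d * (√(2 * Real.pi / d) * √(2 * Real.pi * d)) * y by ring, hαs]
    ring
  simp only [key]
  rw [← Complex.exp_add, Complex.exp_eq_exp_iff_exists_int]
  -- `m` is half of `d z² + c_d z`, the number of full turns at the integer `z`.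
  refine ⟨m, ?_⟩
  have hre : Real.pi * (d * (x + z) ^ 2 + parityConst d * (x + z)) =
      Real.pi * (d * x ^ 2 + parityConst d * x) + 2 * Real.pi * d * x * z + m * (2 * Real.pi) := by
    linear_combination Real.pi * hm'
  rw [hre]
  push_cast
  ring

theorem phaseGate_error_lower_bound (d : ℕ) (hd : 0 < d) {κ Δ ε : ℝ} (hκ : 0 < κ)
    (hκ' : κ < 1 / 250) (hΔ : 0 < Δ) (hε : 0 < ε) (hεd : ε ≤ 1 / (2 * d))
    (hκΔ : 1 ≤ 2 * Real.pi * d * Δ / κ) :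
    ENNReal.ofReal (1 / 25 - 32 * (Δ / ε) ^ 2) ≤
      logicalGateError (gkpEncoder d hd κ Δ ε hκ hΔ hε hεd) (phaseChannel d) (phaseGate d) := by
  -- At `ε² = 800 Δ²` the claimed bound is zero, since `32/800 = 1/25`. Below this threshold it is
  -- vacuous; above it, `1 - (93/100)²` exceeds `1/25`.
  by_cases h : 800 * Δ ^ 2 ≤ ε ^ 2
  · have hv : ‖(EuclideanSpace.single ⟨0, hd⟩ 1 : EuclideanSpace ℂ (Fin d))‖ = 1 := by simp
    refine le_trans (ENNReal.ofReal_le_ofReal ?_) (one_sub_sq_overlap_le_logicalGateError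
      (gkpEncoder d hd κ Δ ε hκ hΔ hε hεd) (phaseImplementation d : L2R →L[ℂ] L2R) (phaseGate d)
      hv hv (phaseGate_single_zero d hd))
    rw [gkpEncoder_single]
    have h1 := norm_inner_phaseImplementation_le d hd hκ hκ' hΔ hε hεd hκΔ h
    have h2 : ‖⟪gkpCodeState d hd κ Δ ε ⟨0, hd⟩, (phaseImplementation d : L2R →L[ℂ] L2R)
        (gkpCodeState d hd κ Δ ε ⟨0, hd⟩)⟫_ℂ‖ ^ 2 ≤ (93 / 100) ^ 2 :=
      pow_le_pow_left₀ (norm_nonneg _) h1 2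
    have h3 : 0 ≤ (Δ / ε) ^ 2 := sq_nonneg _
    linarith
  · rw [ENNReal.ofReal_of_nonpos]
    · exact zero_le
    · have h1 : 1 / 800 ≤ (Δ / ε) ^ 2 := by
        rw [div_pow, le_div_iff₀ (by positivity)]
        linarith
      linarith

theorem symGkp_phaseGate_error_lower_bound (d : ℕ) (hd : 0 < d) {κ : ℝ} (hκ : 0 < κ)
    (hκ' : κ < 1 / 250) :
    ENNReal.ofReal (3 / 100) ≤
      logicalGateError (symGkpEncoder d hd κ hκ) (phaseChannel d) (phaseGate d) := by
  have hπ := Real.pi_gt_three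
  have hd0 : (0 : ℝ) < d := by exact_mod_cast hd
  refine le_trans (ENNReal.ofReal_le_ofReal ?_)
    (phaseGate_error_lower_bound d hd hκ hκ' _ _ _ (le_of_eq ?_))
  · have h1 : κ / (2 * Real.pi * d) / (1 / (2 * d)) = κ / Real.pi := by field_simp
    have h2 : κ / Real.pi ≤ 1 / 250 := by
      rw [div_le_iff₀ (by positivity)]
      nlinarith
    have h3 : (κ / Real.pi) ^ 2 ≤ (1 / 250) ^ 2 := by gcongr
    rw [h1]
    linarith
  · field_simp

theorem mainTheorem2 (d : ℕ) (hd : 2 ≤ d) :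
    (∀ (ε κ Δ : ℝ) (hε : 0 < ε) (hεd : ε ≤ 1 / (2 * d)) (hκ : 0 < κ) (_ : κ < 1 / 250)
        (hΔ : 0 < Δ) (_ : 1 ≤ 2 * Real.pi * d * Δ / κ),
        ENNReal.ofReal (1 / 25 - 32 * (Δ / ε) ^ 2) ≤
          logicalGateError (gkpEncoder d (by omega) κ Δ ε hκ hΔ hε hεd)
            (phaseChannel d) (phaseGate d)) ∧
      (∀ (κ : ℝ) (hκ : 0 < κ) (_ : κ < 1 / 250),
        ENNReal.ofReal (3 / 100) ≤
          logicalGateError (symGkpEncoder d (by omega) κ hκ) (phaseChannel d) (phaseGate d)) ∧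
      ¬ Tendsto
        (fun κ : Set.Ioi (0 : ℝ) =>
          logicalGateError (symGkpEncoder d (by omega) κ κ.2) (phaseChannel d) (phaseGate d))
        (comap Subtype.val (𝓝 0)) (𝓝 0) := by
  refine ⟨fun ε κ Δ hε hεd hκ hκ' hΔ hκΔ =>
      phaseGate_error_lower_bound d (by omega) hκ hκ' hΔ hε hεd hκΔ,
    fun κ hκ hκ' => symGkp_phaseGate_error_lower_bound d (by omega) hκ hκ', fun hlim => ?_⟩
  have hpos : (0 : ℝ≥0∞) < ENNReal.ofReal (3 / 100) := by
    rw [ENNReal.ofReal_pos]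
    norm_num
  have h1 := hlim.eventually_lt_const hpos
  have h2 : ∀ᶠ κ : Set.Ioi (0 : ℝ) in comap Subtype.val (𝓝 0), (κ : ℝ) < 1 / 250 :=
    tendsto_comap.eventually_lt_const (by norm_num)
  -- Zero is a limit point of `(0, ∞)`, so the filter is proper and some small `κ` contradicts the
  -- uniform bound.
  have hne : (comap (Subtype.val : Set.Ioi (0 : ℝ) → ℝ) (𝓝 0)).NeBot := by
    rw [← mem_closure_iff_comap_neBot, closure_Ioi]
    exact Set.self_mem_Ici
  obtain ⟨κ, h3, h4⟩ := (h1.and h2).exists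
  exact absurd h3 (not_lt.2 (symGkp_phaseGate_error_lower_bound d (by omega) κ.2 h4))
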